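/- Let $(\Omega,\Sigma,\mu)$ and $(S,\mathcal F,m)$ be finite measure spaces with $m(S)>0$. Let $L_0=L_0(\Omega)$ be the algebra of classes of measurable functions $\Omega\to\mathbb C$ and $L_0^h$ its real part, with the a.e. order; for $\lambda,\mu\in L_0^h$ write $\lambda\ll\mu$ if $\lambda(\omega)<\mu(\omega)$ for a.e. $\omega$. Let $q\in[0,\infty]$ and let $H$ be the space of classes of measurable functions $x:\Omega\times S\to\mathbb C$ such that $x(\omega,\cdot)\in L_2(S)$ for a.e. $\omega$ and $\int_S|x(\cdot,s)|^2\,dm(s)\in L_q(\Omega)$. (For $q=2$ this is the space $L_{2,2}(\Omega\times S)$ defined by the condition $\int_S|x(\cdot,s)|^2dm(s)\in L_2(\Omega)$; for $q=1$ it is $L_2(\Omega\times S)$; $L_q$ with $q=0$ means all measurable functions, so that $H=L_0(\Omega,L_2(S))$.) Put $\langle x,y\rangle(\omega)=\int_S x(\omega,s)\overline{y(\omega,s)}\,dm(s)\in L_0$ and $\|x\|=\langle x,x\rangle^{1/2}$. A linear map $C:H\to H$ is $L_0$-linear if $C(\alpha x)=\alpha Cx$ whenever $\alpha\in L_0$ and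 $x,\alpha x\in H$, and $L_0$-bounded if for every $B\subseteq H$ with $\{\|x\|:x\in B\}$ bounded above in $L_0^h$ the set $\{\|Cx\|:x\in B\}$ is bounded above in $L_0^h$. An orthogonal projector is an $L_0$-linear, $L_0$-bounded map $P:H\to H$ with $P^2=P$ and $\langle Px,y\rangle=\langle x,Py\rangle$. For operators on $H$ (with values in measurable functions on $\Omega\times S$), $A\le B$ means $\langle Ax,x\rangle\le\langle Bx,x\rangle$ in $L_0$ for all $x\in H$ (the difference is real and nonnegative a.e.). Let $k\in L_\infty(\Omega\times S^2)$ satisfy $k(\omega,t,s)=\overline{k(\omega,s,t)}$ a.e. and, for every $x\in H$, $\int_S\int_S k(\omega,t,s)x(\omega,s)\overline{x(\omega,t)}\,dm(s)\,dm(t)\ge0$ for a.e. $\omega$. Let $T:H\to H$ be the partial integral operator $$(Tx)(\omega,t)=\int_S k(\omega,t,s)\,x(\omega,s)\,dm(s),$$ and let $T_\omega$ be the integral operator on $L_2(S)$ with kernel $k(\omega,\cdot,\cdot)$. Then $\mathbf m=\inf_{\|x\|=1}\langle Tx,x\rangle$ and $\mathbf M=\sup_{\|x\|=1}\langle Tx,x\rangle$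 exist in $L_0^h$, and there is a family $\{E_\lambda\}_{\lambda\in L_0^h}$ of orthogonal projectors in $H$ which is glued from fiberwise spectral projections, that is, for all $\lambda\in L_0^h$ and $x\in H$, for a.e. $\omega$, $(E_\lambda x)(\omega,\cdot)$ is the orthogonal projection of $x(\omega,\cdot)$ in $L_2(S)$ onto the closed linear span of the eigenvectors of $T_\omega$ with eigenvalue $<\lambda(\omega)$, and which has the following properties: - $E_\lambda C=CE_\lambda$ for every $\lambda\in L_0^h$ and every $L_0$-linear $L_0$-bounded $C:H\to H$ with $CT=TC$; - $E_\lambda T\le\lambda E_\lambda$ and $\lambda(I-E_\lambda)\le T(I-E_\lambda)$ for every $\lambda\in L_0^h$; - $E_\lambda\le E_\mu$ whenever $\lambda\le\mu$ (in particular, whenever $\lambda\ll\mu$); - for every $\mu\in L_0^h$ and $x\in H$, $\langle E_\mu x,x\rangle=\sup_{\lambda\ll\mu}\langle E_\lambda x,x\rangle$, the supremum being taken in the ordered space $L_0$; - $E_\lambda=0$ if $\lambda\ll\mathbf m$, and $E_\lambda=I$ if $\mathbf M\ll\lambda$. -/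

import Mathlib

open MeasureTheory Filter
open scoped ENNReal ComplexOrder

namespace PartialIntegral

noncomputable section


variable {Ω S : Type*} [MeasurableSpace Ω] [MeasurableSpace S]

/-! ### Scalars: `L₀(Ω) = Ω →ₘ[μ] ℂ` and its real part `L₀ʰ(Ω) = Ω →ₘ[μ] ℝ` -/

/-- The inclusion `L₀ʰ(Ω) ⊆ L₀(Ω)`. -/
def toComplex {μ : Measure Ω} (l : Ω →ₘ[μ] ℝ) : Ω →ₘ[μ] ℂ :=
  AEEqFun.comp (fun r : ℝ => (r : ℂ)) Complex.continuous_ofReal l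

/-- `l ≪ l'`: strict inequality almost everywhere. -/
def StrictlyBelow {μ : Measure Ω} (l l' : Ω →ₘ[μ] ℝ) : Prop :=
  ∀ᵐ ω ∂μ, l ω < l' ω

variable (μ : Measure Ω) (m : Measure S) [IsFiniteMeasure μ] [IsFiniteMeasure m]

/-! ### The module `L₂,₂(Ω × S)` -/

/-- The module action of `L₀(Ω)` on measurable functions of two variables:
`(a • x)(ω, s) = a(ω) x(ω, s)`. -/
def scalarMul (a : Ω →ₘ[μ] ℂ) (x : Ω × S →ₘ[μ.prod m] ℂ) : Ω × S →ₘ[μ.prod m] ℂ :=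
  a.compQuasiMeasurePreserving Prod.fst Measure.quasiMeasurePreserving_fst * x

/-- Classes of measurable functions `x` on `Ω × S` such that `x(ω, ·)` is in `L₂(S)` for almost
every `ω` and the function `ω ↦ ∫ |x(ω, s)|² dm(s)` belongs to `L_q(Ω)`.
For `q = 2` this is the condition `∫ |x(·, s)|² dm(s) ∈ L₂(Ω)`; for `q = 1` it is `L₂(Ω × S)`, i.e.
`∫∫ |x|² dm dμ < ∞`; for `q = 0` it is the module `L₀(Ω, L₂(S))` of all measurable sections. -/
def L22 (q : ℝ≥0∞) : Submodule ℂ (Ω × S →ₘ[μ.prod m] ℂ) where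
  carrier := {x | (∀ᵐ ω ∂μ, MemLp (fun s => x (ω, s)) 2 m) ∧
    MemLp (fun ω => ∫ s, ‖x (ω, s)‖ ^ 2 ∂m) q μ}
  zero_mem' := by
    have h0 := Measure.ae_ae_of_ae_prod (AEEqFun.coeFn_zero (μ := μ.prod m) (β := ℂ))
    refine ⟨?_, ?_⟩
    · filter_upwards [h0] with ω hω
      exact (MemLp.zero (p := 2) (μ := m) (ε := ℂ)).ae_eq (EventuallyEq.symm hω)
    · refine (MemLp.zero (p := q) (μ := μ) (ε := ℝ)).ae_eq ?_
      filter_upwards [h0] with ω hω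
      have : (fun s => ‖(0 : Ω × S →ₘ[μ.prod m] ℂ) (ω, s)‖ ^ 2) =ᵐ[m] fun _ => (0 : ℝ) := by
        filter_upwards [hω] with s hs
        rw [hs]; simp
      simp [integral_congr_ae this]
  add_mem' := by
    rintro x y ⟨hx1, hx2⟩ ⟨hy1, hy2⟩
    have h0 := Measure.ae_ae_of_ae_prod (AEEqFun.coeFn_add x y)
    refine ⟨?_, ?_⟩
    · filter_upwards [h0, hx1, hy1] with ω hω h1 h2
      exact (h1.add h2).ae_eq (EventuallyEq.symm hω)
    · refine MemLp.mono ((hx2.const_mul 2).add (hy2.const_mul 2))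
        ((x + y).aestronglyMeasurable.norm.pow 2).integral_prod_right' ?_
      filter_upwards [h0, hx1, hy1] with ω hω h1 h2
      have i1 := (memLp_two_iff_integrable_sq_norm h1.1).1 h1
      have i2 := (memLp_two_iff_integrable_sq_norm h2.1).1 h2
      have : ∫ s, ‖(x + y) (ω, s)‖ ^ 2 ∂m
          ≤ ∫ s, (2 * ‖x (ω, s)‖ ^ 2 + 2 * ‖y (ω, s)‖ ^ 2) ∂m := by
        refine integral_mono_of_nonneg (Eventually.of_forall fun s => by positivity)
          ((i1.const_mul 2).add (i2.const_mul 2)) ?_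
        filter_upwards [hω] with s hs
        rw [hs]
        have := norm_add_le (x (ω, s)) (y (ω, s))
        simp only [Pi.add_apply]
        nlinarith [norm_nonneg (x (ω, s) + y (ω, s)), sq_nonneg (‖x (ω, s)‖ - ‖y (ω, s)‖)]
      rw [integral_add (i1.const_mul 2) (i2.const_mul 2), integral_const_mul,
        integral_const_mul] at this
      have hn : 0 ≤ ∫ s, ‖(x + y) (ω, s)‖ ^ 2 ∂m := integral_nonneg fun s => by positivity
      rw [Real.norm_of_nonneg hn]
      exact this.trans (le_abs_self _)
  smul_mem' := by
    rintro c x ⟨hx1, hx2⟩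
    have h0 := Measure.ae_ae_of_ae_prod (AEEqFun.coeFn_smul c x)
    refine ⟨?_, ?_⟩
    · filter_upwards [h0, hx1] with ω hω h1
      exact (h1.const_smul c).ae_eq (EventuallyEq.symm hω)
    · refine (hx2.const_mul (‖c‖ ^ 2)).ae_eq ?_
      filter_upwards [h0] with ω hω
      have : (fun s => ‖(c • x) (ω, s)‖ ^ 2) =ᵐ[m] fun s => ‖c‖ ^ 2 * ‖x (ω, s)‖ ^ 2 := by
        filter_upwards [hω] with s hs
        rw [hs]; simp [mul_pow]
      rw [integral_congr_ae this, integral_const_mul]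

variable {μ m}

/-- The `L₀(Ω)`-valued inner product `⟨x, y⟩(ω) = ∫ x(ω, s) conj(y(ω, s)) dm(s)`. -/
def inner₀ (x y : Ω × S →ₘ[μ.prod m] ℂ) : Ω →ₘ[μ] ℂ :=
  AEEqFun.mk (fun ω => ∫ s, x (ω, s) * star (y (ω, s)) ∂m)
    (x.aestronglyMeasurable.mul y.aestronglyMeasurable.star).integral_prod_right'

/-- The `L₀(Ω)`-valued norm `‖x‖(ω) = (∫ |x(ω, s)|² dm(s))^{1/2}`. -/
def norm₀ (x : Ω × S →ₘ[μ.prod m] ℂ) : Ω →ₘ[μ] ℝ :=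
  AEEqFun.mk (fun ω => Real.sqrt (∫ s, ‖x (ω, s)‖ ^ 2 ∂m))
    (Real.continuous_sqrt.comp_aestronglyMeasurable
      (x.aestronglyMeasurable.norm.pow 2).integral_prod_right')

/-! ### Operators on `L₂,₂(Ω × S)` -/

/-- `L₀(Ω)`-linearity of a (`ℂ`-linear) operator: `C (a x) = a C x` for all `a ∈ L₀(Ω)` and all `x`
such that `a x` is again in the space. -/
def IsL0Linear {q : ℝ≥0∞} (C : L22 μ m q →ₗ[ℂ] L22 μ m q) : Prop :=
  ∀ (a : Ω →ₘ[μ] ℂ) (x y : L22 μ m q),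
    (y : Ω × S →ₘ[μ.prod m] ℂ) = scalarMul μ m a x →
      (C y : Ω × S →ₘ[μ.prod m] ℂ) = scalarMul μ m a (C x)

/-- A set of elements is bounded if the set of their norms is order bounded in `L₀(Ω)`. -/
def IsL0BoundedSet {q : ℝ≥0∞} (B : Set (L22 μ m q)) : Prop :=
  BddAbove ((fun x : L22 μ m q => norm₀ (x : Ω × S →ₘ[μ.prod m] ℂ)) '' B)

/-- An operator is `L₀`-bounded if it maps bounded sets to bounded sets. -/
def IsL0Bounded {q : ℝ≥0∞} (C : L22 μ m q →ₗ[ℂ] L22 μ m q) : Prop :=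
  ∀ B : Set (L22 μ m q), IsL0BoundedSet B → IsL0BoundedSet (C '' B)

/-- Orthogonal projectors: `L₀`-linear `L₀`-bounded operators `P` with `P² = P = P*`. -/
structure IsOrthogonalProjector {q : ℝ≥0∞} (P : L22 μ m q →ₗ[ℂ] L22 μ m q) : Prop where
  l0_linear : IsL0Linear P
  l0_bounded : IsL0Bounded P
  idempotent : ∀ x, P (P x) = P x
  symmetric : ∀ x y : L22 μ m q,
    inner₀ (P x : Ω × S →ₘ[μ.prod m] ℂ) y = inner₀ (x : Ω × S →ₘ[μ.prod m] ℂ) (P y)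

/-- `A ≤ B`: the inequality `⟨A x, x⟩ ≤ ⟨B x, x⟩` holds in `L₀(Ω)` for all `x`. (On `ℂ`, `z ≤ w`
means that `w - z` is real and nonnegative.) The values of `A` and `B` are allowed to lie
outside of the space, since `l E` with `l ∈ L₀ʰ(Ω)` need not map the space into itself. -/
def OpLE {q : ℝ≥0∞} (A B : L22 μ m q → (Ω × S →ₘ[μ.prod m] ℂ)) : Prop :=
  ∀ x : L22 μ m q, inner₀ (A x) (x : Ω × S →ₘ[μ.prod m] ℂ) ≤ inner₀ (B x) x

/-- The numerical range `{⟨T x, x⟩ : ‖x‖ = 1}` in `L₀(Ω)`. -/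
def numericalRange {q : ℝ≥0∞} (T : L22 μ m q →ₗ[ℂ] L22 μ m q) : Set (Ω →ₘ[μ] ℂ) :=
  {z | ∃ x : L22 μ m q, norm₀ (x : Ω × S →ₘ[μ.prod m] ℂ) = 1 ∧
    z = inner₀ (T x : Ω × S →ₘ[μ.prod m] ℂ) x}

/-! ### Partial integral operators -/

variable (μ m) in
/-- `k ∈ L_∞(Ω × S²)`. -/
def IsBoundedKernel (k : Ω → S → S → ℂ) : Prop :=
  MemLp (fun z : (Ω × S) × S => k z.1.1 z.1.2 z.2) ∞ ((μ.prod m).prod m)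

variable (μ m) in
/-- `k(ω, t, s) = conj k(ω, s, t)` almost everywhere. -/
def IsHermitianKernel (k : Ω → S → S → ℂ) : Prop :=
  ∀ᵐ z : (Ω × S) × S ∂((μ.prod m).prod m), k z.1.1 z.1.2 z.2 = star (k z.1.1 z.2 z.1.2)

variable (μ m) in
/-- `∫∫ k(ω, t, s) x(ω, s) conj(x(ω, t)) dm(s) dm(t) ≥ 0` for all `x` in the space. -/
def IsPosSemidefKernel (q : ℝ≥0∞) (k : Ω → S → S → ℂ) : Prop :=
  ∀ x ∈ L22 μ m q, ∀ᵐ ω ∂μ, 0 ≤ ∫ t, ∫ s, k ω t s * x (ω, s) * star (x (ω, t)) ∂m ∂m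

variable (m) in
/-- The fibre integral operator `(T_ω g)(t) = ∫ k(ω, t, s) g(s) dm(s)`. -/
def fiberOp (k : Ω → S → S → ℂ) (ω : Ω) (g : S → ℂ) : S → ℂ :=
  fun t => ∫ s, k ω t s * g s ∂m

theorem aestronglyMeasurable_kernel_mul {k : Ω → S → S → ℂ} (hk : IsBoundedKernel μ m k)
    (x : Ω × S →ₘ[μ.prod m] ℂ) :
    AEStronglyMeasurable (fun z : (Ω × S) × S => k z.1.1 z.1.2 z.2 * x (z.1.1, z.2))
      ((μ.prod m).prod m) :=
  hk.1.mul (x.aestronglyMeasurable.comp_quasiMeasurePreserving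
    (MeasureTheory.QuasiMeasurePreserving.prodMap
      (Measure.quasiMeasurePreserving_fst (μ := μ) (ν := m)) (Measure.QuasiMeasurePreserving.id m)))

theorem aestronglyMeasurable_fiberOp {k : Ω → S → S → ℂ} (hk : IsBoundedKernel μ m k)
    (x : Ω × S →ₘ[μ.prod m] ℂ) :
    AEStronglyMeasurable (fun z : Ω × S => fiberOp m k z.1 (fun s => x (z.1, s)) z.2)
      (μ.prod m) :=
  (aestronglyMeasurable_kernel_mul hk x).integral_prod_right'

theorem kernel_ae_bound {k : Ω → S → S → ℂ} (hk : IsBoundedKernel μ m k) :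
    ∃ K : ℝ, ∀ᵐ z ∂((μ.prod m).prod m), ‖k z.1.1 z.1.2 z.2‖ ≤ K := by
  refine ⟨(eLpNormEssSup (fun z : (Ω × S) × S => k z.1.1 z.1.2 z.2) ((μ.prod m).prod m)).toReal, ?_⟩
  have h2 := hk.2
  rw [eLpNorm_exponent_top] at h2
  filter_upwards [enorm_ae_le_eLpNormEssSup (fun z : (Ω × S) × S => k z.1.1 z.1.2 z.2)
    ((μ.prod m).prod m)] with z hz
  have := ENNReal.toReal_mono h2.ne hz
  rwa [toReal_enorm] at this

/-- `(T x)(ω, t) = ∫ k(ω, t, s) x(ω, s) dm(s)` as a class of measurable functions. -/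
def partialInt {k : Ω → S → S → ℂ} (hk : IsBoundedKernel μ m k)
    (x : Ω × S →ₘ[μ.prod m] ℂ) : Ω × S →ₘ[μ.prod m] ℂ :=
  AEEqFun.mk (fun z => fiberOp m k z.1 (fun s => x (z.1, s)) z.2)
    (aestronglyMeasurable_fiberOp hk x)

theorem kernel_bound {k : Ω → S → S → ℂ} (hk : IsBoundedKernel μ m k) :
    ∃ K : ℝ, 0 ≤ K ∧ ∀ᵐ ω ∂μ, ∀ᵐ t ∂m,
      AEStronglyMeasurable (fun s => k ω t s) m ∧ ∀ᵐ s ∂m, ‖k ω t s‖ ≤ K := by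
  obtain ⟨K, hK⟩ := kernel_ae_bound hk
  refine ⟨max K 0, le_max_right _ _, ?_⟩
  have h1 := Measure.ae_ae_of_ae_prod (Measure.ae_ae_of_ae_prod hK)
  have h2 := Measure.ae_ae_of_ae_prod hk.1.prodMk_left
  filter_upwards [h1, h2] with ω a b
  filter_upwards [a, b] with t c d
  exact ⟨d, c.mono fun s hs => hs.trans (le_max_left _ _)⟩

theorem sq_integral_norm_le {g : S → ℂ} (hg : MemLp g 2 m) :
    (∫ s, ‖g s‖ ∂m) ^ 2 ≤ m.real Set.univ * ∫ s, ‖g s‖ ^ 2 ∂m := by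
  have i1 : Integrable (fun s => ‖g s‖) m := (hg.integrable one_le_two).norm
  have i2 : Integrable (fun s => ‖g s‖ ^ 2) m := (memLp_two_iff_integrable_sq_norm hg.1).1 hg
  set c := m.real Set.univ with hc
  set I := ∫ s, ‖g s‖ ∂m with hI
  set J := ∫ s, ‖g s‖ ^ 2 ∂m with hJ
  have hc0 : 0 ≤ c := measureReal_nonneg
  have key : 0 ≤ ∫ s, (c ^ 2 * ‖g s‖ ^ 2 - 2 * c * I * ‖g s‖ + I ^ 2) ∂m := by
    refine integral_nonneg fun s => ?_
    have := sq_nonneg (c * ‖g s‖ - I)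
    simp only [Pi.zero_apply]
    nlinarith
  have j2 : Integrable (fun s => c ^ 2 * ‖g s‖ ^ 2) m := i2.const_mul _
  have j1 : Integrable (fun s => 2 * c * I * ‖g s‖) m := i1.const_mul _
  have j3 : Integrable (fun s => c ^ 2 * ‖g s‖ ^ 2 - 2 * c * I * ‖g s‖) m := j2.sub j1
  rw [integral_add j3 (integrable_const _), integral_sub j2 j1, integral_const_mul, integral_const_mul,
    integral_const, smul_eq_mul, ← hc, ← hI, ← hJ] at key
  rcases hc0.eq_or_lt with h | h
  · have hm : m = 0 := by
      rw [← Measure.measure_univ_eq_zero]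
      have := h.symm
      rwa [hc, measureReal_eq_zero_iff] at this
    have : I = 0 := by rw [hI, hm]; simp
    rw [← h, this]; simp
  · by_contra! hcon
    nlinarith [mul_pos h (sub_pos.2 hcon)]

theorem norm_fiberOp_le {k : Ω → S → S → ℂ} {ω : Ω} {t : S} {K : ℝ}
    (h : ∀ᵐ s ∂m, ‖k ω t s‖ ≤ K) {g : S → ℂ} (hg : MemLp g 2 m) :
    ‖fiberOp m k ω g t‖ ≤ K * ∫ s, ‖g s‖ ∂m := by
  have i1 : Integrable (fun s => ‖g s‖) m := (hg.integrable one_le_two).norm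
  rw [← integral_const_mul]
  refine norm_integral_le_of_norm_le (i1.const_mul K) ?_
  filter_upwards [h] with s hs
  rw [norm_mul]
  exact mul_le_mul_of_nonneg_right hs (norm_nonneg _)

theorem partialInt_mem {k : Ω → S → S → ℂ} (hk : IsBoundedKernel μ m k) {q : ℝ≥0∞}
    {x : Ω × S →ₘ[μ.prod m] ℂ} (hx : x ∈ L22 μ m q) : partialInt hk x ∈ L22 μ m q := by
  obtain ⟨hx1, hx2⟩ := hx
  obtain ⟨K, hK0, hK⟩ := kernel_bound hk
  have hmk := Measure.ae_ae_of_ae_prod (AEEqFun.coeFn_mk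
    (fun z : Ω × S => fiberOp m k z.1 (fun s => x (z.1, s)) z.2)
    (aestronglyMeasurable_fiberOp hk x))
  have hmeas := (partialInt hk x).aestronglyMeasurable.prodMk_left
  have hbd : ∀ᵐ ω ∂μ, ∀ᵐ t ∂m, ‖partialInt hk x (ω, t)‖ ≤ K * ∫ s, ‖x (ω, s)‖ ∂m := by
    filter_upwards [hmk, hK, hx1] with ω h1 h2 h3
    filter_upwards [h1, h2] with t h4 h5
    rw [partialInt, h4]
    exact norm_fiberOp_le h5.2 h3
  refine ⟨?_, ?_⟩
  · filter_upwards [hmeas, hbd] with ω h1 h2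
    exact MemLp.of_bound h1 _ h2
  · refine MemLp.mono (hx2.const_mul ((K * m.real Set.univ) ^ 2))
      ((partialInt hk x).aestronglyMeasurable.norm.pow 2).integral_prod_right' ?_
    filter_upwards [hbd, hx1] with ω h1 h2
    have h3 : ∫ t, ‖partialInt hk x (ω, t)‖ ^ 2 ∂m
        ≤ ∫ _t, (K * ∫ s, ‖x (ω, s)‖ ∂m) ^ 2 ∂m := by
      refine integral_mono_of_nonneg (Eventually.of_forall fun s => by positivity)
        (integrable_const _) ?_
      filter_upwards [h1] with t ht
      exact pow_le_pow_left₀ (norm_nonneg _) ht 2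
    rw [integral_const, smul_eq_mul] at h3
    have h4 := sq_integral_norm_le h2
    have hc0 : 0 ≤ m.real Set.univ := measureReal_nonneg
    have hn : 0 ≤ ∫ s, ‖partialInt hk x (ω, s)‖ ^ 2 ∂m := integral_nonneg fun s => by positivity
    rw [Real.norm_of_nonneg hn]
    refine le_trans ?_ (le_abs_self _)
    calc _ ≤ _ := h3
      _ = m.real Set.univ * K ^ 2 * (∫ s, ‖x (ω, s)‖ ∂m) ^ 2 := by ring
      _ ≤ m.real Set.univ * K ^ 2 * (m.real Set.univ * ∫ s, ‖x (ω, s)‖ ^ 2 ∂m) := by gcongr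
      _ = _ := by ring

theorem integrable_kernel_mul {k : Ω → S → S → ℂ} {ω : Ω} {t : S} {K : ℝ}
    (hm : AEStronglyMeasurable (fun s => k ω t s) m)
    (h : ∀ᵐ s ∂m, ‖k ω t s‖ ≤ K) {g : S → ℂ} (hg : MemLp g 2 m) :
    Integrable (fun s => k ω t s * g s) m :=
  (hg.integrable one_le_two).bdd_mul hm h

/-- The partial integral operator `(T x)(ω, t) = ∫ k(ω, t, s) x(ω, s) dm(s)`. -/
def partialIntegralOperator {k : Ω → S → S → ℂ} (hk : IsBoundedKernel μ m k) (q : ℝ≥0∞) :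
    L22 μ m q →ₗ[ℂ] L22 μ m q where
  toFun x := ⟨partialInt hk x, partialInt_mem hk x.2⟩
  map_add' := by
    rintro ⟨x, hx⟩ ⟨y, hy⟩
    apply Subtype.ext
    change partialInt hk (x + y) = partialInt hk x + partialInt hk y
    rw [partialInt, partialInt, partialInt, AEEqFun.mk_add_mk, AEEqFun.mk_eq_mk]
    have h0 := Measure.ae_ae_of_ae_prod (AEEqFun.coeFn_add x y)
    have hA : ∀ᵐ z ∂(μ.prod m), AEStronglyMeasurable (fun s => k z.1 z.2 s) m := hk.1.prodMk_left
    obtain ⟨K', hK'⟩ := kernel_ae_bound hk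
    have hB : ∀ᵐ z ∂(μ.prod m), ∀ᵐ s ∂m, ‖k z.1 z.2 s‖ ≤ K' := Measure.ae_ae_of_ae_prod hK'
    have q1 := Measure.quasiMeasurePreserving_fst (μ := μ) (ν := m)
    filter_upwards [hA, hB, q1.ae h0, q1.ae hx.1, q1.ae hy.1] with z hzA hzB hz h1 h2
    simp only [Pi.add_apply, fiberOp]
    rw [← integral_add (integrable_kernel_mul hzA hzB h1) (integrable_kernel_mul hzA hzB h2)]
    refine integral_congr_ae ?_
    filter_upwards [hz] with s hs
    rw [hs, Pi.add_apply, mul_add]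
  map_smul' := by
    rintro c ⟨x, hx⟩
    apply Subtype.ext
    change partialInt hk (c • x) = c • partialInt hk x
    rw [partialInt, partialInt, AEEqFun.smul_mk, AEEqFun.mk_eq_mk]
    have h0 := Measure.ae_ae_of_ae_prod (AEEqFun.coeFn_smul c x)
    have q1 := Measure.quasiMeasurePreserving_fst (μ := μ) (ν := m)
    filter_upwards [q1.ae h0] with z hz
    simp only [Pi.smul_apply, fiberOp, smul_eq_mul]
    rw [← integral_const_mul]
    refine integral_congr_ae ?_
    filter_upwards [hz] with s hs
    rw [hs, Pi.smul_apply, smul_eq_mul]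
    ring

/-! ### Fibrewise spectral projections -/

variable (m) in
/-- The closed linear span in `L₂(S)` of all eigenvectors of the fibre operator `T_ω` with
(real) eigenvalue `< c`. -/
def fiberSpectralSubspace (k : Ω → S → S → ℂ) (ω : Ω) (c : ℝ) : Submodule ℂ (Lp ℂ 2 m) :=
  (Submodule.span ℂ {g : Lp ℂ 2 m | ∃ r : ℝ, r < c ∧
    fiberOp m k ω g =ᵐ[m] fun t => (r : ℂ) * g t}).topologicalClosure

variable (m) in
/-- The spectral projection of `T_ω` for `(-∞, c)`: the orthogonal projection of `L₂(S)` onto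
`fiberSpectralSubspace m k ω c`. -/
def fiberSpectralProjection (k : Ω → S → S → ℂ) (ω : Ω) (c : ℝ) : Lp ℂ 2 m →L[ℂ] Lp ℂ 2 m :=
  haveI : CompleteSpace (fiberSpectralSubspace m k ω c) :=
    (Submodule.isClosed_topologicalClosure _).completeSpace_coe
  (fiberSpectralSubspace m k ω c).starProjection

/-- `P` is glued from the fibrewise spectral projections of `T_ω` for `(-∞, l(ω))`: for every `x`,
`(P x)(ω, ·)` is the image of `x(ω, ·) ∈ L₂(S)` for almost every `ω`. -/
def IsGluedFrom {q : ℝ≥0∞} (k : Ω → S → S → ℂ) (l : Ω →ₘ[μ] ℝ)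
    (P : L22 μ m q →ₗ[ℂ] L22 μ m q) : Prop :=
  ∀ x : L22 μ m q, ∀ᵐ ω ∂μ,
    ∃ hx : MemLp (fun s => (x : Ω × S →ₘ[μ.prod m] ℂ) (ω, s)) 2 m,
      (fun t => (P x : Ω × S →ₘ[μ.prod m] ℂ) (ω, t)) =ᵐ[m]
        fiberSpectralProjection m k ω (l ω) hx.toLp

end

end PartialIntegral

open PartialIntegral

/-!
Almost every fibre `T_ω` is a self-adjoint Hilbert–Schmidt operator, so its eigenvectors are total
in `L₂(S)` and every inequality between functions of `T_ω` can be checked on eigenvectors. The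
only difficulty is to glue the fibrewise spectral projections `P_ω` for `(-∞, l(ω))` measurably.
Take real polynomials that are uniformly bounded on `[-1, 1]` and converge there to the indicator of
`[-1, 0)`. Applied to `(T_ω - l(ω)) / (N + |l(ω)| + 1)` with `‖T_ω‖ ≤ N`, they are uniformly bounded
operators that converge strongly to `P_ω`. They are polynomials in `T` with coefficients in
`L_∞(Ω)`, so the limits glue and the polynomials commute with every `L₀`-linear `C` that commutes
with `T`. Commutation passes to the limit because an `L₀`-bounded `L₀`-linear operator is Lipschitz
on almost every fibre.

Order completeness of `L₀ʰ(Ω)` provides the bounds of the numerical range, and scaling a vector to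
norm one on almost every fibre turns them into bounds for the quadratic form of `T_ω`.
-/

namespace PartialIntegral

noncomputable section

open Polynomial
open scoped Topology InnerProductSpace

/-! ### Functions of a compact symmetric operator -/

section Hilbert

variable {H : Type*} [NormedAddCommGroup H] [InnerProductSpace ℂ H]

/-- The eigenspace of `T` for the real number `r`; it is `⊥` unless `r` is an eigenvalue. -/
abbrev realEigenspace (T : H →L[ℂ] H) (r : ℝ) : Submodule ℂ H :=
  Module.End.eigenspace (T : Module.End ℂ H) (r : ℂ)

/-- `B` is the function `f(T)` of `T` on the eigenvectors of `T` with real eigenvalues: it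
multiplies each eigenvector with eigenvalue `r` by `f r`. -/
def IsDiag (T B : H →L[ℂ] H) (f : ℝ → ℝ) : Prop :=
  ∀ (r : ℝ) (v : H), T v = (r : ℂ) • v → B v = (f r : ℂ) • v

theorem mem_realEigenspace {T : H →L[ℂ] H} {r : ℝ} {v : H} :
    v ∈ realEigenspace T r ↔ T v = (r : ℂ) • v :=
  Module.End.mem_eigenspace_iff

theorem abs_le_opNorm_of_mem_realEigenspace {T : H →L[ℂ] H} {r : ℝ} {v : H}
    (hv : v ∈ realEigenspace T r) (h0 : v ≠ 0) : |r| ≤ ‖T‖ := by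
  have h := T.le_opNorm v
  rw [mem_realEigenspace.1 hv, norm_smul, Complex.norm_real, Real.norm_eq_abs] at h
  exact le_of_mul_le_mul_right h (norm_pos_iff.2 h0)

namespace IsDiag

variable {T B B' : H →L[ℂ] H} {f f' : ℝ → ℝ}

theorem one : IsDiag T 1 fun _ => 1 := fun r v _ => by simp

theorem self : IsDiag T T fun r => r := fun _ _ h => h

theorem add (h : IsDiag T B f) (h' : IsDiag T B' f') : IsDiag T (B + B') fun r => f r + f' r :=
  fun r v hv => by simp [h r v hv, h' r v hv, add_smul]

theorem sub (h : IsDiag T B f) (h' : IsDiag T B' f') : IsDiag T (B - B') fun r => f r - f' r :=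
  fun r v hv => by simp [h r v hv, h' r v hv, sub_smul]

theorem smul (c : ℝ) (h : IsDiag T B f) : IsDiag T ((c : ℂ) • B) fun r => c * f r :=
  fun r v hv => by simp [h r v hv, mul_smul]

theorem mul (h : IsDiag T B f) (h' : IsDiag T B' f') : IsDiag T (B * B') fun r => f r * f' r :=
  fun r v hv => by
    rw [mul_apply_eq_comp, h' r v hv, map_smul, h r v hv, smul_smul,
      Complex.ofReal_mul, mul_comm]

theorem aeval (h : IsDiag T B f) (p : ℝ[X]) :
    IsDiag T (Polynomial.aeval B p) fun r => p.eval (f r) := by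
  induction p using Polynomial.induction_on' with
  | add p p' hp hp' => simpa only [map_add, eval_add] using hp.add hp'
  | monomial n c =>
    induction n with
    | zero =>
      simpa [Algebra.algebraMap_eq_smul_one, ← Complex.coe_smul] using IsDiag.one.smul c
    | succ n ih =>
      simpa [← monomial_mul_X, ← mul_assoc] using ih.mul h

theorem map_sum (h : IsDiag T B f) (s : Finset ℝ) (a : ∀ r, realEigenspace T r) :
    B (∑ r ∈ s, (a r : H)) = ∑ r ∈ s, (((f r : ℂ) • a r : realEigenspace T r) : H) := by
  rw [_root_.map_sum]
  exact Finset.sum_congr rfl fun r _ => h r _ (mem_realEigenspace.1 (a r).2)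

end IsDiag

/-- Compact symmetric operators, whose eigenvectors with real eigenvalue are total. -/
structure IsCompactSymmetric (T : H →L[ℂ] H) : Prop where
  isCompactOperator : IsCompactOperator T
  isSymmetric : (T : H →ₗ[ℂ] H).IsSymmetric

theorem orthogonalFamily_realEigenspace {T : H →L[ℂ] H} (hT : (T : H →ₗ[ℂ] H).IsSymmetric) :
    OrthogonalFamily ℂ (fun r : ℝ => realEigenspace T r)
      fun r => (realEigenspace T r).subtypeₗᵢ :=
  hT.orthogonalFamily_eigenspaces.comp Complex.ofReal_injective

section Complete

variable [CompleteSpace H] {T : H →L[ℂ] H}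

namespace IsCompactSymmetric

theorem topologicalClosure_iSup_realEigenspace (hT : IsCompactSymmetric T) :
    (⨆ r : ℝ, realEigenspace T r).topologicalClosure = ⊤ := by
  rw [Submodule.topologicalClosure_eq_top_iff, eq_bot_iff,
    ← ContinuousLinearMap.orthogonalComplement_iSup_eigenspaces_eq_bot
      hT.isCompactOperator hT.isSymmetric]
  refine Submodule.orthogonal_le (iSup_le fun z => ?_)
  by_cases hz : Module.End.HasEigenvalue (T : Module.End ℂ H) z
  · obtain ⟨r, rfl⟩ := Complex.conj_eq_iff_real.1 (hT.isSymmetric.conj_eigenvalue_eq_self hz)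
    exact le_iSup (realEigenspace T) r
  · rw [Module.End.hasEigenvalue_iff, not_not] at hz
    exact hz.le.trans bot_le

theorem induction_on_eigenvector_sums (hT : IsCompactSymmetric T) {P : H → Prop}
    (hP : IsClosed {x | P x})
    (hsum : ∀ (s : Finset ℝ) (a : ∀ r, realEigenspace T r), (∀ r ∈ s, |r| ≤ ‖T‖) →
      P (∑ r ∈ s, (a r : H))) (x : H) : P x := by
  classical
  refine (Submodule.dense_iff_topologicalClosure_eq_top.2
    hT.topologicalClosure_iSup_realEigenspace).induction (fun x hx => ?_) hP x
  obtain ⟨a, rfl⟩ := (Submodule.mem_iSup_iff_exists_dfinsupp _ x).1 hx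
  convert hsum a.support a fun r hr => abs_le_opNorm_of_mem_realEigenspace (a r).2 ?_
  · exact (DFinsupp.lsum_apply_apply _ _ _).trans (DFinsupp.sumAddHom_apply _ _)
  · exact fun h => DFinsupp.mem_support_iff.1 hr (Subtype.ext h)

variable {B : H →L[ℂ] H} {f : ℝ → ℝ}

theorem inner_nonneg (hT : IsCompactSymmetric T) (hB : IsDiag T B f)
    (hf : ∀ r, |r| ≤ ‖T‖ → 0 ≤ f r) (x : H) : 0 ≤ ⟪x, B x⟫_ℂ := by
  have := Complex.orderClosedTopology
  refine hT.induction_on_eigenvector_sums (P := fun x => 0 ≤ ⟪x, B x⟫_ℂ)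
    (isClosed_le continuous_const (continuous_id.inner B.continuous)) (fun s a hs => ?_) x
  have horth := (orthogonalFamily_realEigenspace hT.isSymmetric).inner_sum a
    (fun r => (f r : ℂ) • a r) s
  simp only [Submodule.coe_subtypeₗᵢ, Submodule.subtype_apply] at horth
  rw [hB.map_sum, horth]
  refine Finset.sum_nonneg fun r hr => ?_
  rw [inner_smul_right, inner_self_eq_norm_sq_to_K]
  exact mul_nonneg (Complex.zero_le_real.2 (hf r (hs r hr)))
    (pow_nonneg (RCLike.ofReal_nonneg.2 (norm_nonneg _)) 2)

theorem norm_apply_le (hT : IsCompactSymmetric T) (hB : IsDiag T B f) {M : ℝ}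
    (hf : ∀ r, |r| ≤ ‖T‖ → |f r| ≤ M) (x : H) : ‖B x‖ ≤ M * ‖x‖ := by
  have hM : 0 ≤ M := (abs_nonneg _).trans (hf 0 (by simp))
  refine hT.induction_on_eigenvector_sums (P := fun x => ‖B x‖ ≤ M * ‖x‖)
    (isClosed_le B.continuous.norm (continuous_const.mul continuous_norm)) (fun s a hs => ?_) x
  have hpyth := (orthogonalFamily_realEigenspace hT.isSymmetric).norm_sum
  simp only [Submodule.coe_subtypeₗᵢ, Submodule.subtype_apply] at hpyth
  refine le_of_sq_le_sq ?_ (by positivity)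
  rw [hB.map_sum, hpyth (fun r => (f r : ℂ) • a r), mul_pow, hpyth a, Finset.mul_sum]
  refine Finset.sum_le_sum fun r hr => ?_
  rw [norm_smul, mul_pow, Complex.norm_real, Real.norm_eq_abs]
  gcongr
  exact hf r (hs r hr)

theorem tendsto_apply (hT : IsCompactSymmetric T) (hB : IsDiag T B f) {ι : Type*} {l : Filter ι}
    {A : ι → H →L[ℂ] H} {g : ι → ℝ → ℝ} (hA : ∀ i, IsDiag T (A i) (g i)) {M : ℝ}
    (hM : ∀ i r, |r| ≤ ‖T‖ → |g i r| ≤ M)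
    (hg : ∀ r, |r| ≤ ‖T‖ → Tendsto (fun i => g i r) l (𝓝 (f r))) (x : H) :
    Tendsto (fun i => A i x) l (𝓝 (B x)) := by
  have hequi : Equicontinuous fun i => (A i : H → H) := by
    refine (LipschitzWith.uniformEquicontinuous _ M.toNNReal fun i => ?_).equicontinuous
    refine (A i).lipschitz.weaken (NNReal.coe_le_coe.1 ?_)
    exact (A i).opNorm_le_bound NNReal.zero_le_coe fun x =>
      (hT.norm_apply_le (hA i) (hM i) x).trans (by gcongr; exact Real.le_coe_toNNReal M)
  refine hT.induction_on_eigenvector_sums (P := fun x => Tendsto (fun i => A i x) l (𝓝 (B x)))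
    (hequi.isClosed_setOfPred_tendsto B.continuous) (fun s a hs => ?_) x
  simp only [hB.map_sum, (hA _).map_sum, Submodule.coe_smul]
  exact tendsto_finsetSum _ fun r hr =>
    ((Complex.continuous_ofReal.tendsto _).comp (hg r (hs r hr))).smul_const _

end IsCompactSymmetric
end Complete
end Hilbert

/-! ### Spectral projections as limits of polynomials -/

theorem exists_polynomial_tendsto {a b M : ℝ} {f : ℕ → ℝ → ℝ} {g : ℝ → ℝ}
    (hf : ∀ n, ContinuousOn (f n) (Set.Icc a b)) (hM : ∀ n, ∀ t ∈ Set.Icc a b, |f n t| ≤ M)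
    (hg : ∀ t ∈ Set.Icc a b, Tendsto (fun n => f n t) atTop (𝓝 (g t))) :
    ∃ p : ℕ → ℝ[X], ∀ t ∈ Set.Icc a b,
      (∀ n, |(p n).eval t| ≤ M + 1) ∧ Tendsto (fun n => (p n).eval t) atTop (𝓝 (g t)) := by
  choose p hp using fun n : ℕ =>
    exists_polynomial_near_of_continuousOn a b (f n) (hf n) (1 / ((n : ℝ) + 1)) (by positivity)
  refine ⟨p, fun t ht => ⟨fun n => ?_, ?_⟩⟩
  · have hn : 1 / ((n : ℝ) + 1) ≤ 1 := by
      rw [div_le_one (by positivity)]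
      linarith [n.cast_nonneg (α := ℝ)]
    linarith [abs_sub_abs_le_abs_sub ((p n).eval t) (f n t), hp n t ht, hM n t ht]
  · have hdiff : Tendsto (fun n => (p n).eval t - f n t) atTop (𝓝 0) :=
      squeeze_zero_norm (fun n => (hp n t ht).le) tendsto_one_div_add_atTop_nhds_zero_nat
    simpa using hdiff.add (hg t ht)

theorem tendsto_ramp_indicator (t : ℝ) :
    Tendsto (fun n : ℕ => max 0 (min 1 (-(n * t)))) atTop (𝓝 (if t < 0 then 1 else 0)) := by
  split_ifs with ht
  · refine tendsto_const_nhds.congr' ?_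
    have hlim : Tendsto (fun n : ℕ => (n : ℝ) * -t) atTop atTop :=
      tendsto_natCast_atTop_atTop.atTop_mul_const (neg_pos.2 ht)
    filter_upwards [hlim.eventually_ge_atTop 1] with n hn
    rw [← mul_neg, min_eq_left hn, max_eq_right zero_le_one]
  · refine tendsto_const_nhds.congr fun n => ?_
    have hn : -(n * t) ≤ 0 := neg_nonpos.2 (mul_nonneg n.cast_nonneg (not_lt.1 ht))
    rw [max_eq_left ((min_le_right _ _).trans hn)]

theorem exists_polynomial_tendsto_indicator : ∃ p : ℕ → ℝ[X], ∀ t ∈ Set.Icc (-1 : ℝ) 1,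
    (∀ n, |(p n).eval t| ≤ 2) ∧
      Tendsto (fun n => (p n).eval t) atTop (𝓝 (if t < 0 then 1 else 0)) := by
  rw [← one_add_one_eq_two]
  refine exists_polynomial_tendsto (f := fun n t => max 0 (min 1 (-(n * t))))
    (fun n => by fun_prop) (fun n t _ => ?_) fun t _ => tendsto_ramp_indicator t
  rw [abs_of_nonneg (le_max_left _ _)]
  exact max_le zero_le_one (min_le_left _ _)

section Hilbert

variable {H : Type*} [NormedAddCommGroup H] [InnerProductSpace ℂ H]

/-- `(T - c) / (N + |c| + 1)`, an operator whose spectrum lies in `[-1, 1]` if `T` is self-adjoint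
of norm at most `N`. Dividing by `N + |c| + 1` also makes the coefficients bounded functions of
`c`. -/
def rescale (N : ℝ) (T : H →L[ℂ] H) (c : ℝ) : H →L[ℂ] H :=
  (((N + |c| + 1)⁻¹ : ℝ) : ℂ) • (T - (c : ℂ) • 1)

theorem isDiag_rescale (N : ℝ) (T : H →L[ℂ] H) (c : ℝ) :
    IsDiag T (rescale N T c) fun r => (N + |c| + 1)⁻¹ * (r - c) := by
  simpa only [rescale, mul_one] using (IsDiag.self.sub (IsDiag.one.smul c)).smul (N + |c| + 1)⁻¹

theorem inv_mul_sub_mem_Icc {N r : ℝ} (hr : |r| ≤ N) (c : ℝ) :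
    (N + |c| + 1)⁻¹ * (r - c) ∈ Set.Icc (-1 : ℝ) 1 := by
  have hp : 0 < N + |c| + 1 := by linarith [abs_nonneg r, abs_nonneg c]
  rw [Set.mem_Icc, ← abs_le, abs_mul, abs_of_pos (inv_pos.2 hp), inv_mul_le_one₀ hp]
  linarith [abs_sub r c]

/-- The closed linear span of the eigenvectors of `T` with real eigenvalue `< c`. -/
def spectralSubspace (T : H →L[ℂ] H) (c : ℝ) : Submodule ℂ H :=
  (Submodule.span ℂ {g : H | ∃ r : ℝ, r < c ∧ T g = (r : ℂ) • g}).topologicalClosure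

variable [CompleteSpace H]

instance (T : H →L[ℂ] H) (c : ℝ) : CompleteSpace (spectralSubspace T c) :=
  (Submodule.isClosed_topologicalClosure _).completeSpace_coe

/-- The spectral projection of `T` for `(-∞, c)`: the orthogonal projection onto
`spectralSubspace T c`. -/
def spectralProjection (T : H →L[ℂ] H) (c : ℝ) : H →L[ℂ] H :=
  (spectralSubspace T c).starProjection

variable {T : H →L[ℂ] H}

theorem isDiag_spectralProjection (hT : (T : H →ₗ[ℂ] H).IsSymmetric) (c : ℝ) :
    IsDiag T (spectralProjection T c) fun r => if r < c then 1 else 0 := by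
  intro r v hv
  beta_reduce
  split_ifs with hr
  · rw [Complex.ofReal_one, one_smul]
    exact Submodule.starProjection_eq_self_iff.2
      (Submodule.le_topologicalClosure _ (Submodule.subset_span ⟨r, hr, hv⟩))
  · rw [Complex.ofReal_zero, zero_smul]
    refine (Submodule.starProjection_apply_eq_zero_iff _).2 ?_
    rw [spectralSubspace, Submodule.orthogonal_closure]
    refine Submodule.isOrtho_span.2 ?_ (Submodule.mem_span_singleton_self v)
    rintro _ rfl w ⟨r', hr', hw⟩
    exact (orthogonalFamily_realEigenspace hT) (show r ≠ r' by rintro rfl; exact hr hr')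
      ⟨_, mem_realEigenspace.2 hv⟩ ⟨w, mem_realEigenspace.2 hw⟩

theorem spectralProjection_spectralProjection (T : H →L[ℂ] H) (c : ℝ) (x : H) :
    spectralProjection T c (spectralProjection T c x) = spectralProjection T c x :=
  Submodule.starProjection_eq_self_iff.2 (Submodule.starProjection_apply_mem _ x)

theorem inner_spectralProjection_left (T : H →L[ℂ] H) (c : ℝ) (x y : H) :
    ⟪spectralProjection T c x, y⟫_ℂ = ⟪x, spectralProjection T c y⟫_ℂ :=
  Submodule.inner_starProjection_left_eq_right _ x y

namespace IsCompactSymmetric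

theorem norm_aeval_rescale_apply_le (hT : IsCompactSymmetric T) {N M : ℝ} (hN : ‖T‖ ≤ N)
    {p : ℝ[X]} (hp : ∀ t ∈ Set.Icc (-1 : ℝ) 1, |p.eval t| ≤ M) (c : ℝ) (x : H) :
    ‖aeval (rescale N T c) p x‖ ≤ M * ‖x‖ :=
  hT.norm_apply_le ((isDiag_rescale N T c).aeval p)
    (fun _ hr => hp _ (inv_mul_sub_mem_Icc (hr.trans hN) c)) x

theorem tendsto_aeval_rescale_apply (hT : IsCompactSymmetric T) {N M : ℝ} (hN : ‖T‖ ≤ N)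
    {p : ℕ → ℝ[X]} (hp : ∀ t ∈ Set.Icc (-1 : ℝ) 1, (∀ n, |(p n).eval t| ≤ M) ∧
      Tendsto (fun n => (p n).eval t) atTop (𝓝 (if t < 0 then 1 else 0))) (c : ℝ) (x : H) :
    Tendsto (fun n => aeval (rescale N T c) (p n) x) atTop (𝓝 (spectralProjection T c x)) := by
  refine hT.tendsto_apply (isDiag_spectralProjection hT.isSymmetric c)
    (fun n => (isDiag_rescale N T c).aeval (p n))
    (fun n r hr => (hp _ (inv_mul_sub_mem_Icc (hr.trans hN) c)).1 n) (fun r hr => ?_) x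
  have hpos : 0 < (N + |c| + 1)⁻¹ :=
    inv_pos.2 (by linarith [norm_nonneg T, abs_nonneg c])
  simpa only [← smul_eq_mul, smul_neg_iff_of_pos_left hpos, sub_neg] using
    (hp _ (inv_mul_sub_mem_Icc (hr.trans hN) c)).2

theorem tendsto_spectralProjection_of_lt (hT : IsCompactSymmetric T) {c : ℝ} {u : ℕ → ℝ}
    (hu : Tendsto u atTop (𝓝 c)) (hlt : ∀ n, u n < c) (x : H) :
    Tendsto (fun n => spectralProjection T (u n) x) atTop (𝓝 (spectralProjection T c x)) := by
  refine hT.tendsto_apply (M := 1) (isDiag_spectralProjection hT.isSymmetric c)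
    (fun n => isDiag_spectralProjection hT.isSymmetric (u n))
    (fun n r _ => by split_ifs <;> simp) (fun r _ => ?_) x
  refine tendsto_const_nhds.congr' ?_
  by_cases hr : r < c
  · filter_upwards [hu.eventually (lt_mem_nhds hr)] with n hn
    rw [if_pos hr, if_pos hn]
  · exact Eventually.of_forall fun n => by
      simp only [if_neg hr, if_neg fun h : r < u n => hr (h.trans (hlt n))]

theorem inner_spectralProjection_mono (hT : IsCompactSymmetric T) {c c' : ℝ} (h : c ≤ c')
    (x : H) : ⟪x, spectralProjection T c x⟫_ℂ ≤ ⟪x, spectralProjection T c' x⟫_ℂ := by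
  rw [← sub_nonneg, ← inner_sub_right, ← sub_apply]
  exact hT.inner_nonneg ((isDiag_spectralProjection hT.isSymmetric c').sub
    (isDiag_spectralProjection hT.isSymmetric c)) (fun r _ => by split_ifs <;> linarith) x

theorem inner_spectralProjection_apply_le (hT : IsCompactSymmetric T) (c : ℝ) (x : H) :
    ⟪x, spectralProjection T c (T x)⟫_ℂ ≤ ⟪x, (c : ℂ) • spectralProjection T c x⟫_ℂ := by
  have hP := isDiag_spectralProjection hT.isSymmetric c
  rw [← sub_nonneg, ← inner_sub_right]
  exact hT.inner_nonneg ((hP.smul c).sub (hP.mul IsDiag.self))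
    (fun r _ => by split_ifs <;> linarith) x

theorem inner_smul_le_apply_sub_spectralProjection (hT : IsCompactSymmetric T) (c : ℝ) (x : H) :
    ⟪x, (c : ℂ) • (x - spectralProjection T c x)⟫_ℂ ≤
      ⟪x, T (x - spectralProjection T c x)⟫_ℂ := by
  have hQ := IsDiag.one.sub (isDiag_spectralProjection hT.isSymmetric c)
  rw [← sub_nonneg, ← inner_sub_right]
  exact hT.inner_nonneg ((IsDiag.self.mul hQ).sub (hQ.smul c))
    (fun r _ => by split_ifs <;> linarith) x

theorem spectralProjection_apply_eq_zero (hT : IsCompactSymmetric T) {c d : ℝ} (hcd : c < d)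
    (x : H) (hd : ((d * ‖spectralProjection T c x‖ ^ 2 : ℝ) : ℂ) ≤
      ⟪spectralProjection T c x, T (spectralProjection T c x)⟫_ℂ) :
    spectralProjection T c x = 0 := by
  set v := spectralProjection T c x
  have hPv : spectralProjection T c v = v := spectralProjection_spectralProjection T c x
  have h := hT.inner_spectralProjection_apply_le c v
  rw [← inner_spectralProjection_left, hPv, inner_smul_right, inner_self_eq_norm_sq_to_K] at h
  have h' : d * ‖v‖ ^ 2 ≤ c * ‖v‖ ^ 2 := by
    refine Complex.real_le_real.1 (hd.trans ?_)
    simpa using h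
  by_contra h0
  exact hcd.not_ge (le_of_mul_le_mul_right h' (by positivity))

theorem spectralProjection_apply_eq_self (hT : IsCompactSymmetric T) {c d : ℝ} (hdc : d < c)
    (x : H) (hd : ⟪x - spectralProjection T c x, T (x - spectralProjection T c x)⟫_ℂ ≤
      ((d * ‖x - spectralProjection T c x‖ ^ 2 : ℝ) : ℂ)) :
    spectralProjection T c x = x := by
  set v := x - spectralProjection T c x with hv
  have hPv : spectralProjection T c v = 0 := by
    rw [hv, map_sub, spectralProjection_spectralProjection, sub_self]
  have h := hT.inner_smul_le_apply_sub_spectralProjection c v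
  rw [hPv, sub_zero, inner_smul_right, inner_self_eq_norm_sq_to_K] at h
  have h' : c * ‖v‖ ^ 2 ≤ d * ‖v‖ ^ 2 := by
    refine Complex.real_le_real.1 (le_trans ?_ hd)
    simpa using h
  by_contra h0
  have hv0 : v ≠ 0 := fun h => h0 (sub_eq_zero.1 h).symm
  exact hdc.not_ge (le_of_mul_le_mul_right h' (by positivity))

end IsCompactSymmetric
end Hilbert

/-! ### Hilbert–Schmidt operators are compact -/

section HilbertSchmidt

variable {𝕜 ι H F : Type*} [RCLike 𝕜] [NormedAddCommGroup H] [InnerProductSpace 𝕜 H]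
  [NormedAddCommGroup F] [NormedSpace 𝕜 F]

/-- The finite-rank operator `T ∘ P`, where `P` is the orthogonal projection onto the span of the
basis vectors `b i`, `i ∈ s`. -/
def basisTruncation (b : HilbertBasis ι 𝕜 H) (T : H →L[𝕜] F) (s : Finset ι) : H →L[𝕜] F :=
  ∑ i ∈ s, (innerSL 𝕜 (b i)).smulRight (T (b i))

variable (b : HilbertBasis ι 𝕜 H) (T : H →L[𝕜] F)

theorem basisTruncation_apply (s : Finset ι) (v : H) :
    basisTruncation b T s v = ∑ i ∈ s, inner 𝕜 (b i) v • T (b i) := by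
  simp [basisTruncation]

theorem isCompactOperator_basisTruncation (s : Finset ι) :
    IsCompactOperator (basisTruncation b T s) := by
  refine Finset.sum_induction _ (fun A : H →L[𝕜] F => IsCompactOperator A)
    (fun A A' hA hA' => hA.add hA') isCompactOperator_zero fun i _ => ?_
  have hb : IsCompactOperator (innerSL 𝕜 (b i)) :=
    isCompactOperator_of_locallyCompactSpace_dom (innerSL 𝕜 (b i))
  exact hb.clm_comp (ContinuousLinearMap.toSpanSingleton 𝕜 (T (b i)))

theorem tendsto_basisTruncation_apply (v : H) :
    Tendsto (fun s => basisTruncation b T s v) atTop (𝓝 (T v)) := by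
  simpa [HasSum, basisTruncation_apply, b.repr_apply_apply] using (b.hasSum_repr v).mapL T

variable {b T}

theorem norm_basisTruncation_apply_le {s : Finset ι} {ε : ℝ} (hε : 0 ≤ ε)
    (h : ∑ i ∈ s, ‖T (b i)‖ ^ 2 ≤ ε ^ 2) (v : H) : ‖basisTruncation b T s v‖ ≤ ε * ‖v‖ := by
  rw [basisTruncation_apply]
  refine (norm_sum_le_of_le s fun i _ => (norm_smul (inner 𝕜 (b i) v) (T (b i))).le).trans ?_
  refine le_of_sq_le_sq ?_ (by positivity)
  calc (∑ i ∈ s, ‖inner 𝕜 (b i) v‖ * ‖T (b i)‖) ^ 2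
      ≤ (∑ i ∈ s, ‖inner 𝕜 (b i) v‖ ^ 2) * ∑ i ∈ s, ‖T (b i)‖ ^ 2 :=
        Finset.sum_mul_sq_le_sq_mul_sq s _ _
    _ ≤ ‖v‖ ^ 2 * ε ^ 2 := by
        gcongr
        exact b.orthonormal.sum_inner_products_le v
    _ = (ε * ‖v‖) ^ 2 := by ring

theorem norm_basisTruncation_sub_le {s : Finset ι} {ε : ℝ} (hε : 0 ≤ ε)
    (h : ∀ t, Disjoint t s → ∑ i ∈ t, ‖T (b i)‖ ^ 2 ≤ ε ^ 2) :
    ‖basisTruncation b T s - T‖ ≤ ε := by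
  classical
  refine ContinuousLinearMap.opNorm_le_bound _ hε fun v => ?_
  rw [sub_apply]
  refine le_of_tendsto (tendsto_const_nhds.sub (tendsto_basisTruncation_apply b T v)).norm ?_
  filter_upwards [eventually_ge_atTop s] with u hu
  have htail : basisTruncation b T s v - basisTruncation b T u v =
      -basisTruncation b T (u \ s) v := by
    simp only [basisTruncation_apply, ← Finset.sum_sdiff hu]
    abel
  rw [htail, norm_neg]
  exact norm_basisTruncation_apply_le hε (h _ Finset.sdiff_disjoint) v

theorem isCompactOperator_of_forall_sum_sq_norm_le [CompleteSpace F] {C : ℝ}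
    (h : ∀ s : Finset ι, ∑ i ∈ s, ‖T (b i)‖ ^ 2 ≤ C) : IsCompactOperator T := by
  classical
  have hsum : Summable fun i => ‖T (b i)‖ ^ 2 := summable_of_sum_le (fun _ => by positivity) h
  have hlim : Tendsto (basisTruncation b T) atTop (𝓝 T) := by
    refine Metric.tendsto_atTop.2 fun ε hε => ?_
    obtain ⟨s, hs⟩ := summable_iff_vanishing_norm.1 hsum ((ε / 2) ^ 2) (by positivity)
    refine ⟨s, fun t ht => ?_⟩
    have htail : ∀ u, Disjoint u t → ∑ i ∈ u, ‖T (b i)‖ ^ 2 ≤ (ε / 2) ^ 2 := fun u hu =>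
      (le_abs_self _).trans (hs u (Finset.disjoint_of_subset_right ht hu)).le
    rw [dist_eq_norm]
    exact (norm_basisTruncation_sub_le (half_pos hε).le htail).trans_lt (half_lt_self hε)
  exact isCompactOperator_of_tendsto hlim (.of_forall (isCompactOperator_basisTruncation b T))

end HilbertSchmidt

/-! ### The fibre integral operators on `L₂(S)` -/

section Fiber

variable {Ω S : Type*} [MeasurableSpace S] {m : Measure S}

theorem norm_sq_eq_integral_norm_sq (g : Lp ℂ 2 m) : ‖g‖ ^ 2 = ∫ s, ‖g s‖ ^ 2 ∂m := by
  have h : ⟪g, g⟫_ℂ = ∫ s, ⟪g s, g s⟫_ℂ ∂m := L2.inner_def g g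
  simp only [inner_self_eq_norm_sq_to_K] at h
  have hcast : ∫ s, ((‖g s‖ ^ 2 : ℝ) : ℂ) ∂m = ((∫ s, ‖g s‖ ^ 2 ∂m : ℝ) : ℂ) := integral_ofReal
  refine Complex.ofReal_injective (Eq.trans ?_ hcast)
  push_cast
  exact h

theorem norm_toLp_sq_eq_integral {g : S → ℂ} (hg : MemLp g 2 m) :
    ‖hg.toLp‖ ^ 2 = ∫ s, ‖g s‖ ^ 2 ∂m := by
  rw [norm_sq_eq_integral_norm_sq]
  exact integral_congr_ae (hg.coeFn_toLp.mono fun s hs => by simp only [hs])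

theorem fiberOp_congr (k : Ω → S → S → ℂ) (ω : Ω) {g g' : S → ℂ} (h : g =ᵐ[m] g') :
    fiberOp m k ω g = fiberOp m k ω g' :=
  funext fun _ => integral_congr_ae (h.mono fun s hs => by simp only [hs])

theorem fiberOp_smul (k : Ω → S → S → ℂ) (ω : Ω) (c : ℂ) (g : S → ℂ) :
    fiberOp m k ω (c • g) = c • fiberOp m k ω g := by
  funext t
  simp only [fiberOp, Pi.smul_apply, smul_eq_mul, ← integral_const_mul, mul_left_comm c]

theorem fiberOp_eq_inner {k : Ω → S → S → ℂ} {ω : Ω} {t : S}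
    (hrow : MemLp (fun s => star (k ω t s)) 2 m) (g : Lp ℂ 2 m) :
    fiberOp m k ω g t = ⟪hrow.toLp, g⟫_ℂ := by
  rw [L2.inner_def]
  refine integral_congr_ae ?_
  filter_upwards [hrow.coeFn_toLp] with s hs
  rw [RCLike.inner_apply, hs, starRingEnd_apply, star_star, mul_comm]

variable (m) in
/-- A measurable hermitian kernel on `S × S` bounded by `K`: what almost every fibre
`k(ω, ·, ·)` of a bounded hermitian kernel is. -/
structure IsFiberKernel (K : ℝ) (κ : S → S → ℂ) : Prop where
  nonneg : 0 ≤ K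
  meas : AEStronglyMeasurable (fun p : S × S => κ p.1 p.2) (m.prod m)
  bound : ∀ᵐ p ∂(m.prod m), ‖κ p.1 p.2‖ ≤ K
  herm : ∀ᵐ p ∂(m.prod m), κ p.1 p.2 = star (κ p.2 p.1)

variable [IsFiniteMeasure m]

theorem integral_norm_sq_le_of_ae_norm_le {E : Type*} [NormedAddCommGroup E] {f : S → E} {c : ℝ}
    (h : ∀ᵐ t ∂m, ‖f t‖ ≤ c) : ∫ t, ‖f t‖ ^ 2 ∂m ≤ m.real Set.univ * c ^ 2 := by
  have hle : ∫ t, ‖f t‖ ^ 2 ∂m ≤ ∫ _, c ^ 2 ∂m :=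
    integral_mono_of_nonneg (.of_forall fun t => by positivity) (integrable_const _)
      (h.mono fun t ht => pow_le_pow_left₀ (norm_nonneg _) ht 2)
  rwa [integral_const, smul_eq_mul] at hle

namespace IsFiberKernel

variable {K : ℝ} {k : Ω → S → S → ℂ} {ω : Ω}

theorem ae_aestronglyMeasurable (h : IsFiberKernel m K (k ω)) :
    ∀ᵐ t ∂m, AEStronglyMeasurable (k ω t) m := h.meas.prodMk_left

theorem ae_ae_norm_le (h : IsFiberKernel m K (k ω)) : ∀ᵐ t ∂m, ∀ᵐ s ∂m, ‖k ω t s‖ ≤ K :=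
  Measure.ae_ae_of_ae_prod h.bound

theorem sum_norm_fiberOp_sq_le (h : IsFiberKernel m K (k ω)) {ι : Type*} {v : ι → Lp ℂ 2 m}
    (hv : Orthonormal ℂ v) (s : Finset ι) :
    ∀ᵐ t ∂m, ∑ i ∈ s, ‖fiberOp m k ω (v i) t‖ ^ 2 ≤ m.real Set.univ * K ^ 2 := by
  filter_upwards [h.ae_aestronglyMeasurable, h.ae_ae_norm_le] with t hmeas hbound
  have hstar : ∀ᵐ s ∂m, ‖star (k ω t s)‖ ≤ K := hbound.mono fun s hs => by rwa [norm_star]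
  have hrow : MemLp (fun s => star (k ω t s)) 2 m := MemLp.of_bound hmeas.star K hstar
  calc ∑ i ∈ s, ‖fiberOp m k ω (v i) t‖ ^ 2
      = ∑ i ∈ s, ‖⟪v i, hrow.toLp⟫_ℂ‖ ^ 2 := by simp only [fiberOp_eq_inner hrow, norm_inner_symm]
    _ ≤ ‖hrow.toLp‖ ^ 2 := hv.sum_inner_products_le _
    _ ≤ m.real Set.univ * K ^ 2 :=
        (norm_toLp_sq_eq_integral hrow).trans_le (integral_norm_sq_le_of_ae_norm_le hstar)

variable [MeasurableSpace Ω]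

theorem ae_norm_fiberOp_le (h : IsFiberKernel m K (k ω)) {g : S → ℂ} (hg : MemLp g 2 m) :
    ∀ᵐ t ∂m, ‖fiberOp m k ω g t‖ ≤ K * ∫ s, ‖g s‖ ∂m :=
  h.ae_ae_norm_le.mono fun _ ht => norm_fiberOp_le ht hg

theorem memLp_fiberOp (h : IsFiberKernel m K (k ω)) {g : S → ℂ} (hg : MemLp g 2 m) :
    MemLp (fiberOp m k ω g) 2 m :=
  MemLp.of_bound (h.meas.mul hg.1.comp_snd).integral_prod_right' _ (h.ae_norm_fiberOp_le hg)

theorem fiberOp_add (h : IsFiberKernel m K (k ω)) {f g : S → ℂ} (hf : MemLp f 2 m)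
    (hg : MemLp g 2 m) : fiberOp m k ω (f + g) =ᵐ[m] fiberOp m k ω f + fiberOp m k ω g := by
  filter_upwards [h.ae_aestronglyMeasurable, h.ae_ae_norm_le] with t hmeas hbound
  simp only [fiberOp, Pi.add_apply, mul_add]
  exact integral_add (integrable_kernel_mul hmeas hbound hf) (integrable_kernel_mul hmeas hbound hg)

theorem integral_norm_fiberOp_sq_le (h : IsFiberKernel m K (k ω)) {g : S → ℂ}
    (hg : MemLp g 2 m) :
    ∫ t, ‖fiberOp m k ω g t‖ ^ 2 ∂m ≤ (K * m.real Set.univ) ^ 2 * ∫ s, ‖g s‖ ^ 2 ∂m := by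
  calc ∫ t, ‖fiberOp m k ω g t‖ ^ 2 ∂m
      ≤ m.real Set.univ * (K * ∫ s, ‖g s‖ ∂m) ^ 2 :=
        integral_norm_sq_le_of_ae_norm_le (h.ae_norm_fiberOp_le hg)
    _ = m.real Set.univ * K ^ 2 * (∫ s, ‖g s‖ ∂m) ^ 2 := by ring
    _ ≤ m.real Set.univ * K ^ 2 * (m.real Set.univ * ∫ s, ‖g s‖ ^ 2 ∂m) := by
        gcongr
        exact sq_integral_norm_le hg
    _ = (K * m.real Set.univ) ^ 2 * ∫ s, ‖g s‖ ^ 2 ∂m := by ring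

/-- The integral operator with kernel `k(ω, ·, ·)` as a linear map of `L₂(S)`. -/
def linearMap (h : IsFiberKernel m K (k ω)) : Lp ℂ 2 m →ₗ[ℂ] Lp ℂ 2 m where
  toFun g := (h.memLp_fiberOp (Lp.memLp g)).toLp
  map_add' f g := by
    rw [← MemLp.toLp_add, MemLp.toLp_eq_toLp_iff, fiberOp_congr k ω (Lp.coeFn_add f g)]
    exact h.fiberOp_add (Lp.memLp f) (Lp.memLp g)
  map_smul' c g := by
    rw [RingHom.id_apply, ← MemLp.toLp_const_smul, MemLp.toLp_eq_toLp_iff,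
      fiberOp_congr k ω (Lp.coeFn_smul c g), fiberOp_smul]

theorem norm_linearMap_le (h : IsFiberKernel m K (k ω)) (g : Lp ℂ 2 m) :
    ‖h.linearMap g‖ ≤ K * m.real Set.univ * ‖g‖ := by
  have hK := h.nonneg
  refine le_of_sq_le_sq ?_ (by positivity)
  rw [mul_pow, norm_sq_eq_integral_norm_sq g]
  exact (norm_toLp_sq_eq_integral (h.memLp_fiberOp (Lp.memLp g))).trans_le
    (h.integral_norm_fiberOp_sq_le (Lp.memLp g))

end IsFiberKernel

variable [MeasurableSpace Ω]

open Classical in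
variable (m) in
/-- The fibre operator `T_ω` as a bounded operator of `L₂(S)`; by convention it is zero unless
`k(ω, ·, ·)` is measurable, hermitian and bounded by `K`. -/
def fiberCLM (k : Ω → S → S → ℂ) (K : ℝ) (ω : Ω) : Lp ℂ 2 m →L[ℂ] Lp ℂ 2 m :=
  if h : IsFiberKernel m K (k ω) then
    h.linearMap.mkContinuous (K * m.real Set.univ) h.norm_linearMap_le
  else 0

variable {K : ℝ} {k : Ω → S → S → ℂ} {ω : Ω}

theorem norm_fiberCLM_le (hK : 0 ≤ K) : ‖fiberCLM m k K ω‖ ≤ K * m.real Set.univ := by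
  have hbound : 0 ≤ K * m.real Set.univ := by positivity
  unfold fiberCLM
  split_ifs
  · exact LinearMap.mkContinuous_norm_le _ hbound _
  · rwa [norm_zero]

theorem fiberCLM_apply (h : IsFiberKernel m K (k ω)) (g : Lp ℂ 2 m) :
    fiberCLM m k K ω g = (h.memLp_fiberOp (Lp.memLp g)).toLp := by
  rw [fiberCLM, dif_pos h]
  rfl

theorem coeFn_fiberCLM (h : IsFiberKernel m K (k ω)) (g : Lp ℂ 2 m) :
    fiberCLM m k K ω g =ᵐ[m] fiberOp m k ω g := by
  rw [fiberCLM_apply h]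
  exact MemLp.coeFn_toLp _

theorem fiberOp_ae_eq_smul_iff (h : IsFiberKernel m K (k ω)) {g : Lp ℂ 2 m} {r : ℂ} :
    fiberOp m k ω g =ᵐ[m] (fun t => r * g t) ↔ fiberCLM m k K ω g = r • g := by
  rw [Lp.ext_iff]
  have hT := coeFn_fiberCLM h g
  have hr := Lp.coeFn_smul r g
  exact ⟨fun hg => hT.trans (hg.trans hr.symm), fun hg => hT.symm.trans (hg.trans hr)⟩

theorem fiberSpectralProjection_eq_spectralProjection (h : IsFiberKernel m K (k ω)) (c : ℝ) :
    fiberSpectralProjection m k ω c = spectralProjection (fiberCLM m k K ω) c := by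
  have : fiberSpectralSubspace m k ω c = spectralSubspace (fiberCLM m k K ω) c := by
    simp only [fiberSpectralSubspace, spectralSubspace, fiberOp_ae_eq_smul_iff h]
  unfold fiberSpectralProjection spectralProjection
  congr

theorem isCompactOperator_fiberCLM (h : IsFiberKernel m K (k ω)) :
    IsCompactOperator (fiberCLM m k K ω) := by
  obtain ⟨w, b, -⟩ := exists_hilbertBasis ℂ (Lp ℂ 2 m)
  refine isCompactOperator_of_forall_sum_sq_norm_le (b := b)
    (C := ∫ _, m.real Set.univ * K ^ 2 ∂m) fun s => ?_
  have hint : ∀ i, Integrable (fun t => ‖fiberOp m k ω (b i) t‖ ^ 2) m := fun i =>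
    (h.memLp_fiberOp (Lp.memLp (b i))).integrable_norm_pow two_ne_zero
  simp only [fiberCLM_apply h, norm_toLp_sq_eq_integral]
  rw [← integral_finsetSum _ fun i _ => hint i]
  exact integral_mono_of_nonneg (.of_forall fun t => by positivity) (integrable_const _)
    (h.sum_norm_fiberOp_sq_le b.orthonormal s)

theorem inner_fiberCLM_right (h : IsFiberKernel m K (k ω)) (f g : Lp ℂ 2 m) :
    ⟪f, fiberCLM m k K ω g⟫_ℂ
      = ∫ p : S × S, k ω p.1 p.2 * (star (f p.1) * g p.2) ∂(m.prod m) := by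
  have hf : Integrable (fun s => star (f s)) m :=
    (LinearIsometryEquiv.integrable_comp_iff (starₗᵢ ℂ)).2 ((Lp.memLp f).integrable one_le_two)
  have hg := (Lp.memLp g).integrable one_le_two
  rw [L2.inner_def, integral_prod _ ((hf.mul_prod hg).bdd_mul h.meas h.bound)]
  refine integral_congr_ae ?_
  filter_upwards [coeFn_fiberCLM h g] with t ht
  rw [ht, fiberOp, RCLike.inner_apply, ← integral_mul_const]
  simp only [starRingEnd_apply, mul_assoc, mul_comm (star _)]

theorem isSymmetric_fiberCLM (h : IsFiberKernel m K (k ω)) :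
    (fiberCLM m k K ω : Lp ℂ 2 m →ₗ[ℂ] Lp ℂ 2 m).IsSymmetric := by
  intro f g
  calc ⟪fiberCLM m k K ω f, g⟫_ℂ
      = ∫ p : S × S, star (k ω p.1 p.2 * (star (g p.1) * f p.2)) ∂(m.prod m) := by
        rw [← inner_conj_symm, inner_fiberCLM_right h, ← integral_conj]
        rfl
    _ = ∫ p : S × S, k ω p.2 p.1 * (star (f p.2) * g p.1) ∂(m.prod m) := by
        refine integral_congr_ae ?_
        filter_upwards [h.herm] with p hp
        simp only [hp, star_mul, star_star, mul_comm]
    _ = ⟪f, fiberCLM m k K ω g⟫_ℂ := by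
        rw [inner_fiberCLM_right h]
        exact integral_prod_swap fun p : S × S => k ω p.1 p.2 * (star (f p.1) * g p.2)

theorem isCompactSymmetric_fiberCLM (h : IsFiberKernel m K (k ω)) :
    IsCompactSymmetric (fiberCLM m k K ω) :=
  ⟨isCompactOperator_fiberCLM h, isSymmetric_fiberCLM h⟩

theorem exists_ae_isFiberKernel {μ : Measure Ω} [IsFiniteMeasure μ]
    (hk : IsBoundedKernel μ m k) (hherm : IsHermitianKernel μ m k) :
    ∃ K : ℝ, 0 ≤ K ∧ ∀ᵐ ω ∂μ, IsFiberKernel m K (k ω) := by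
  obtain ⟨K, hK⟩ := kernel_ae_bound hk
  have hassoc := (measurePreserving_prodAssoc μ m m).symm.quasiMeasurePreserving
  refine ⟨max K 0, le_max_right _ _, ?_⟩
  filter_upwards [Measure.ae_ae_of_ae_prod (hassoc.ae hK),
    Measure.ae_ae_of_ae_prod (hassoc.ae hherm),
    (hk.1.comp_quasiMeasurePreserving hassoc).prodMk_left] with ω hbound hsymm hmeas
  exact ⟨le_max_right _ _, hmeas, hbound.mono fun p hp => hp.trans (le_max_left _ _), hsymm⟩

end Fiber

/-! ### Sections and decomposable operators -/

section Sections

variable {Ω S : Type*} [MeasurableSpace Ω] [MeasurableSpace S] {μ : Measure Ω} {m : Measure S}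

theorem coeFn_toComplex (l : Ω →ₘ[μ] ℝ) : ∀ᵐ ω ∂μ, toComplex l ω = (l ω : ℂ) :=
  AEEqFun.coeFn_comp _ Complex.continuous_ofReal l

theorem coeFn_toComplex_compMeasurable {φ : ℝ → ℝ} (hφ : Measurable φ) (l : Ω →ₘ[μ] ℝ) :
    ∀ᵐ ω ∂μ, toComplex (AEEqFun.compMeasurable φ hφ l) ω = (φ (l ω) : ℂ) := by
  filter_upwards [coeFn_toComplex (AEEqFun.compMeasurable φ hφ l),
    AEEqFun.coeFn_compMeasurable φ hφ l] with ω h1 h2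
  rw [h1, h2, Function.comp_apply]

/-- `f ω ∈ L₂(S)` is the section `u(ω, ·)` for almost every `ω`. -/
def HasSections (u : Ω × S →ₘ[μ.prod m] ℂ) (f : Ω → Lp ℂ 2 m) : Prop :=
  ∀ᵐ ω ∂μ, (fun s => u (ω, s)) =ᵐ[m] f ω

open Classical in
/-- The section `u(ω, ·)` as an element of `L₂(S)`; zero if it is not square integrable. -/
def sec (u : Ω × S →ₘ[μ.prod m] ℂ) (ω : Ω) : Lp ℂ 2 m :=
  if h : MemLp (fun s => u (ω, s)) 2 m then h.toLp else 0

theorem sec_eq_toLp {u : Ω × S →ₘ[μ.prod m] ℂ} {ω : Ω} (h : MemLp (fun s => u (ω, s)) 2 m) :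
    sec u ω = h.toLp := dif_pos h

theorem hasSections_sec_of_memLp {u : Ω × S →ₘ[μ.prod m] ℂ}
    (hu : ∀ᵐ ω ∂μ, MemLp (fun s => u (ω, s)) 2 m) : HasSections u (sec u) := by
  filter_upwards [hu] with ω h
  rw [sec_eq_toLp h]
  exact h.coeFn_toLp.symm

theorem hasSections_sec [IsFiniteMeasure m] {q : ℝ≥0∞} (x : L22 μ m q) :
    HasSections x.1 (sec x.1) :=
  hasSections_sec_of_memLp x.2.1

namespace HasSections

variable {u v : Ω × S →ₘ[μ.prod m] ℂ} {f g : Ω → Lp ℂ 2 m}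

theorem memLp (h : HasSections u f) : ∀ᵐ ω ∂μ, MemLp (fun s => u (ω, s)) 2 m :=
  h.mono fun _ hω => (Lp.memLp _).ae_eq hω.symm

theorem sec_eq (h : HasSections u f) : ∀ᵐ ω ∂μ, sec u ω = f ω := by
  filter_upwards [h, h.memLp] with ω h1 h2
  rw [sec_eq_toLp h2, Lp.ext_iff]
  exact h2.coeFn_toLp.trans h1

theorem congr (hf : HasSections u f) (h : ∀ᵐ ω ∂μ, f ω = g ω) : HasSections u g := by
  filter_upwards [hf, h] with ω h1 h2
  rwa [← h2]

theorem norm_sq (hu : HasSections u f) : ∀ᵐ ω ∂μ, ∫ s, ‖u (ω, s)‖ ^ 2 ∂m = ‖f ω‖ ^ 2 := by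
  filter_upwards [hu] with ω h
  rw [norm_sq_eq_integral_norm_sq]
  exact integral_congr_ae (h.mono fun s hs => by simp only [hs])

section SFinite

variable [SFinite m]

theorem ext (hu : HasSections u f) (hv : HasSections v f) : u = v := by
  refine AEEqFun.ext ?_
  refine (Measure.ae_prod_iff_ae_ae
    (u.stronglyMeasurable.measurableSet_eq_fun v.stronglyMeasurable)).2 ?_
  filter_upwards [hu, hv] with ω h1 h2
  exact h1.trans h2.symm

theorem zero : HasSections (0 : Ω × S →ₘ[μ.prod m] ℂ) fun _ => 0 := by
  filter_upwards [Measure.ae_ae_of_ae_prod (AEEqFun.coeFn_zero (μ := μ.prod m) (β := ℂ))] with ω h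
  exact EventuallyEq.trans h (Lp.coeFn_zero ℂ 2 m).symm

theorem add (hu : HasSections u f) (hv : HasSections v g) :
    HasSections (u + v) fun ω => f ω + g ω := by
  filter_upwards [hu, hv, Measure.ae_ae_of_ae_prod (AEEqFun.coeFn_add u v)] with ω h1 h2 h3
  filter_upwards [h1, h2, h3, Lp.coeFn_add (f ω) (g ω)] with s h1 h2 h3 h4
  rw [h3, h4, Pi.add_apply, Pi.add_apply, h1, h2]

theorem sub (hu : HasSections u f) (hv : HasSections v g) :
    HasSections (u - v) fun ω => f ω - g ω := by
  filter_upwards [hu, hv, Measure.ae_ae_of_ae_prod (AEEqFun.coeFn_sub u v)] with ω h1 h2 h3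
  filter_upwards [h1, h2, h3, Lp.coeFn_sub (f ω) (g ω)] with s h1 h2 h3 h4
  rw [h3, h4, Pi.sub_apply, Pi.sub_apply, h1, h2]

theorem smul (c : ℂ) (hu : HasSections u f) : HasSections (c • u) fun ω => c • f ω := by
  filter_upwards [hu, Measure.ae_ae_of_ae_prod (AEEqFun.coeFn_smul c u)] with ω h1 h3
  filter_upwards [h1, h3, Lp.coeFn_smul c (f ω)] with s h1 h3 h4
  rw [h3, h4, Pi.smul_apply, Pi.smul_apply, h1]

end SFinite

variable [IsFiniteMeasure m]

theorem scalarMul (a : Ω →ₘ[μ] ℂ) (hu : HasSections u f) :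
    HasSections (scalarMul μ m a u) fun ω => a ω • f ω := by
  have h3 := Measure.ae_ae_of_ae_prod (AEEqFun.coeFn_mul
    (a.compQuasiMeasurePreserving Prod.fst (Measure.quasiMeasurePreserving_fst (ν := m))) u)
  have h5 := Measure.ae_ae_of_ae_prod (AEEqFun.coeFn_compQuasiMeasurePreserving a
    (Measure.quasiMeasurePreserving_fst (μ := μ) (ν := m)))
  filter_upwards [hu, h3, h5] with ω h1 h3 h5
  filter_upwards [h1, h3, h5, Lp.coeFn_smul (a ω) (f ω)] with s h1 h3 h5 h4
  rw [PartialIntegral.scalarMul, h3, h4, Pi.smul_apply, Pi.mul_apply, h1, h5, smul_eq_mul]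
  rfl

theorem norm₀ (hu : HasSections u f) : ∀ᵐ ω ∂μ, norm₀ u ω = ‖f ω‖ := by
  filter_upwards [hu.norm_sq, AEEqFun.coeFn_mk (fun ω => Real.sqrt (∫ s, ‖u (ω, s)‖ ^ 2 ∂m))
    (Real.continuous_sqrt.comp_aestronglyMeasurable
      (u.aestronglyMeasurable.norm.pow 2).integral_prod_right')] with ω h1 h2
  rw [PartialIntegral.norm₀, h2, h1, Real.sqrt_sq (norm_nonneg _)]

theorem smul_norm {φ : ℝ → ℝ} (hφ : Measurable φ) (hv : HasSections v g) (hu : HasSections u f) :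
    HasSections (PartialIntegral.scalarMul μ m
      (toComplex (AEEqFun.compMeasurable φ hφ (PartialIntegral.norm₀ v))) u)
      fun ω => (φ ‖g ω‖ : ℂ) • f ω := by
  refine (hu.scalarMul _).congr ?_
  filter_upwards [coeFn_toComplex_compMeasurable hφ (PartialIntegral.norm₀ v), hv.norm₀]
    with ω h1 h2
  rw [h1, h2]

theorem inner₀ (hu : HasSections u f) (hv : HasSections v g) :
    ∀ᵐ ω ∂μ, inner₀ u v ω = ⟪g ω, f ω⟫_ℂ := by
  filter_upwards [hu, hv, AEEqFun.coeFn_mk (fun ω => ∫ s, u (ω, s) * star (v (ω, s)) ∂m)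
    (u.aestronglyMeasurable.mul v.aestronglyMeasurable.star).integral_prod_right']
    with ω h1 h2 h3
  rw [PartialIntegral.inner₀, h3, L2.inner_def]
  refine integral_congr_ae ?_
  filter_upwards [h1, h2] with s h1 h2
  rw [h1, h2, RCLike.inner_apply, starRingEnd_apply]

theorem aestronglyMeasurable_norm (hu : HasSections u f) :
    AEStronglyMeasurable (fun ω => ‖f ω‖) μ :=
  (PartialIntegral.norm₀ u).aestronglyMeasurable.congr hu.norm₀

variable {q : ℝ≥0∞}

theorem mem_of_norm_le {f' : Ω → Lp ℂ 2 m} (hu : HasSections u f) {x : L22 μ m q}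
    (hx : HasSections x.1 f') {C : ℝ}
    (h : ∀ᵐ ω ∂μ, ‖f ω‖ ≤ C * ‖f' ω‖) : u ∈ L22 μ m q := by
  refine ⟨hu.memLp, MemLp.mono (x.2.2.const_mul (C ^ 2))
    (u.aestronglyMeasurable.norm.pow 2).integral_prod_right' ?_⟩
  filter_upwards [hu.norm_sq, hx.norm_sq, h] with ω h1 h2 h3
  rw [h1, h2, ← mul_pow, norm_pow, norm_norm]
  refine le_trans ?_ (le_abs_self _)
  exact pow_le_pow_left₀ (norm_nonneg _) h3 2

theorem mem_of_norm_le_const [IsFiniteMeasure μ] (hu : HasSections u f) {C : ℝ}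
    (h : ∀ᵐ ω ∂μ, ‖f ω‖ ≤ C) : u ∈ L22 μ m q := by
  refine ⟨hu.memLp, MemLp.of_bound
    (u.aestronglyMeasurable.norm.pow 2).integral_prod_right' (C ^ 2) ?_⟩
  filter_upwards [hu.norm_sq, h] with ω h1 h3
  rw [h1, norm_pow, norm_norm]
  exact pow_le_pow_left₀ (norm_nonneg _) h3 2

theorem l22_ext {x y : L22 μ m q} (hx : HasSections x.1 f)
    (hy : HasSections y.1 f) : x = y :=
  Subtype.ext (hx.ext hy)

end HasSections

variable [IsFiniteMeasure m] {q : ℝ≥0∞}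

theorem sec_add (x y : L22 μ m q) : ∀ᵐ ω ∂μ, sec (x + y).1 ω = sec x.1 ω + sec y.1 ω :=
  ((hasSections_sec x).add (hasSections_sec y)).sec_eq

theorem sec_sub (x y : L22 μ m q) : ∀ᵐ ω ∂μ, sec (x - y).1 ω = sec x.1 ω - sec y.1 ω :=
  ((hasSections_sec x).sub (hasSections_sec y)).sec_eq

theorem sec_smul (c : ℂ) (x : L22 μ m q) : ∀ᵐ ω ∂μ, sec (c • x).1 ω = c • sec x.1 ω :=
  ((hasSections_sec x).smul c).sec_eq

/-- Multiplication by an essentially bounded function of `ω`. -/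
def boundedMul (q : ℝ≥0∞) (a : Ω →ₘ[μ] ℂ) (ha : ∃ C : ℝ, ∀ᵐ ω ∂μ, ‖a ω‖ ≤ C) :
    L22 μ m q →ₗ[ℂ] L22 μ m q where
  toFun x := ⟨scalarMul μ m a x.1, by
    obtain ⟨C, hC⟩ := ha
    refine ((hasSections_sec x).scalarMul a).mem_of_norm_le (hasSections_sec x) (C := C) ?_
    filter_upwards [hC] with ω hω
    rw [norm_smul]
    gcongr⟩
  map_add' x y := by
    have h := hasSections_sec x
    have h' := hasSections_sec y
    refine Subtype.ext (HasSections.ext ((h.add h').scalarMul a) ?_)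
    exact ((h.scalarMul a).add (h'.scalarMul a)).congr
      (.of_forall fun ω => (smul_add _ _ _).symm)
  map_smul' c x := by
    have h := hasSections_sec x
    refine Subtype.ext (HasSections.ext ((h.smul c).scalarMul a) ?_)
    exact ((h.scalarMul a).smul c).congr
      (.of_forall fun ω => smul_comm _ _ _)

/-- `B` acts on almost every section `x(ω, ·)` as the operator `b ω`. -/
def Decomposes (B : L22 μ m q →ₗ[ℂ] L22 μ m q) (b : Ω → Lp ℂ 2 m →L[ℂ] Lp ℂ 2 m) : Prop :=
  ∀ x : L22 μ m q, HasSections (B x).1 fun ω => b ω (sec x.1 ω)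

namespace Decomposes

variable {B B' : L22 μ m q →ₗ[ℂ] L22 μ m q} {b b' : Ω → Lp ℂ 2 m →L[ℂ] Lp ℂ 2 m}

theorem apply (h : Decomposes B b) {x : L22 μ m q} {f : Ω → Lp ℂ 2 m}
    (hf : HasSections x.1 f) :
    HasSections (B x).1 fun ω => b ω (f ω) :=
  (h x).congr (hf.sec_eq.mono fun ω hω => by rw [hω])

theorem one : Decomposes (1 : Module.End ℂ (L22 μ m q)) fun _ => 1 := fun x => hasSections_sec x

theorem add (h : Decomposes B b) (h' : Decomposes B' b') :
    Decomposes (B + B') fun ω => b ω + b' ω := fun x => (h x).add (h' x)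

theorem mul (h : Decomposes B b) (h' : Decomposes B' b') :
    Decomposes (B * B' : Module.End ℂ (L22 μ m q)) fun ω => b ω * b' ω := fun x => h.apply (h' x)

theorem boundedMul (a : Ω →ₘ[μ] ℂ) (ha : ∃ C : ℝ, ∀ᵐ ω ∂μ, ‖a ω‖ ≤ C) :
    Decomposes (boundedMul (m := m) q a ha) fun ω => a ω • 1 :=
  fun x => (hasSections_sec x).scalarMul a

theorem congr (h : Decomposes B b) (hb : ∀ᵐ ω ∂μ, b ω = b' ω) : Decomposes B b' :=
  fun x => (h x).congr (hb.mono fun ω hω => by rw [hω])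

theorem aeval (h : Decomposes B b) (p : ℝ[X]) :
    Decomposes (aeval (B : Module.End ℂ (L22 μ m q)) p) fun ω => aeval (b ω) p := by
  induction p using Polynomial.induction_on' with
  | add p p' hp hp' => simpa only [map_add] using hp.add hp'
  | monomial n a =>
    induction n with
    | zero =>
      have h0 : Decomposes (a • (1 : Module.End ℂ (L22 μ m q))) fun _ => a • 1 :=
        fun x => (one x).smul (a : ℂ)
      simpa [Algebra.algebraMap_eq_smul_one] using h0
    | succ n ih => simpa [← monomial_mul_X, ← mul_assoc] using ih.mul h

theorem isL0Linear (h : Decomposes B b) : IsL0Linear B := by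
  intro a x y hy
  have h1 : HasSections y.1 fun ω => a ω • sec x.1 ω := by
    rw [hy]
    exact (hasSections_sec x).scalarMul a
  exact (h.apply h1).ext (((h x).scalarMul a).congr (.of_forall fun ω => by simp))

theorem isL0Bounded (h : Decomposes B b) (hb : ∀ᵐ ω ∂μ, ‖b ω‖ ≤ 1) : IsL0Bounded B := by
  rintro A ⟨c, hc⟩
  refine ⟨c, ?_⟩
  rintro _ ⟨_, ⟨x, hx, rfl⟩, rfl⟩
  refine le_trans ?_ (hc ⟨x, hx, rfl⟩)
  rw [← AEEqFun.coeFn_le]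
  filter_upwards [(h x).norm₀, (hasSections_sec x).norm₀, hb] with ω h1 h2 h3
  simp only [h1, h2]
  exact ((b ω).le_of_opNorm_le h3 _).trans (one_mul _).le

end Decomposes

theorem decomposes_partialIntegralOperator [IsFiniteMeasure μ] {k : Ω → S → S → ℂ}
    (hk : IsBoundedKernel μ m k) {K : ℝ} (h : ∀ᵐ ω ∂μ, IsFiberKernel m K (k ω)) :
    Decomposes (partialIntegralOperator hk q) (fiberCLM m k K) := by
  intro x
  have hmk := Measure.ae_ae_of_ae_prod (AEEqFun.coeFn_mk
    (fun z : Ω × S => fiberOp m k z.1 (fun s => x.1 (z.1, s)) z.2)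
    (aestronglyMeasurable_fiberOp hk x.1))
  filter_upwards [h, hmk, hasSections_sec x] with ω h1 h2 h3
  refine EventuallyEq.trans h2 (EventuallyEq.trans ?_ (coeFn_fiberCLM h1 _).symm)
  rw [← fiberOp_congr k ω h3]

end Sections

/-! ### Gluing fibrewise limits -/

section Gluing

variable {Ω S : Type*} [MeasurableSpace Ω] [MeasurableSpace S] {μ : Measure Ω} {m : Measure S}

theorem tendsto_eLpNorm_zero_of_ae_norm_le [IsFiniteMeasure μ] {E ι : Type*}
    [NormedAddCommGroup E] {l : Filter ι} [l.IsCountablyGenerated] {h : ι → Ω → E} {p : ℝ≥0∞}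
    (hp0 : p ≠ 0) (hp : p ≠ ∞) {C : ℝ}
    (hmeas : ∀ i, AEStronglyMeasurable (fun ω => ‖h i ω‖) μ)
    (hC : ∀ i, ∀ᵐ ω ∂μ, ‖h i ω‖ ≤ C) (hlim : ∀ᵐ ω ∂μ, Tendsto (h · ω) l (𝓝 0)) :
    Tendsto (fun i => eLpNorm (h i) p μ) l (𝓝 0) := by
  have hpos : 0 < p.toReal := ENNReal.toReal_pos hp0 hp
  have hint : Tendsto (fun i => ∫⁻ ω, ‖h i ω‖ₑ ^ p.toReal ∂μ) l (𝓝 (∫⁻ _, 0 ∂μ)) := by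
    refine tendsto_lintegral_filter_of_dominated_convergence'
      (fun _ => ENNReal.ofReal C ^ p.toReal) (.of_forall fun i => ?_) (.of_forall fun i => ?_) ?_ ?_
    · simpa only [enorm_norm] using (hmeas i).enorm.pow_const p.toReal
    · filter_upwards [hC i] with ω hω
      rw [← ofReal_norm]
      gcongr
    · rw [lintegral_const]
      finiteness
    · filter_upwards [hlim] with ω hω
      simpa [hpos] using hω.enorm.ennrpow_const p.toReal
  rw [lintegral_zero] at hint
  simpa [eLpNorm_eq_lintegral_rpow_enorm_toReal hp0 hp, hpos] using
    hint.ennrpow_const (1 / p.toReal)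

theorem eLpNorm_two_rpow_two {E : Type*} [NormedAddCommGroup E] (h : Ω → E) :
    eLpNorm h 2 μ ^ (2 : ℝ) = ∫⁻ ω, ‖h ω‖ₑ ^ (2 : ℝ) ∂μ := by
  simpa only [NNReal.coe_ofNat, ENNReal.coe_ofNat] using
    eLpNorm_nnreal_pow_eq_lintegral (f := h) (μ := μ) (p := 2) two_ne_zero

section SFinite

variable [SFinite m] {u : Ω × S →ₘ[μ.prod m] ℂ} {f : Ω → Lp ℂ 2 m}

/-- This identifies `L₂(Ω × S)` with the square integrable sections `Ω → L₂(S)`. -/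
theorem HasSections.eLpNorm_eq (hu : HasSections u f) :
    eLpNorm u 2 (μ.prod m) = eLpNorm f 2 μ := by
  refine ENNReal.rpow_left_injective (x := 2) two_ne_zero ?_
  simp only [eLpNorm_two_rpow_two]
  rw [lintegral_prod _ (u.aestronglyMeasurable.enorm.pow_const _)]
  refine lintegral_congr_ae ?_
  filter_upwards [hu] with ω hω
  rw [Lp.enorm_def, eLpNorm_two_rpow_two]
  exact lintegral_congr_ae (hω.mono fun s hs => by simp only [hs])

end SFinite

variable [IsFiniteMeasure m]

theorem hasSections_sec_of_L2 [SFinite μ] (Y : Lp ℂ 2 (μ.prod m)) :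
    HasSections Y.1 (sec Y.1) := by
  refine hasSections_sec_of_memLp ?_
  have hY := ((memLp_two_iff_integrable_sq_norm (Lp.memLp Y).1).1 (Lp.memLp Y)).prod_right_ae
  filter_upwards [hY, (Lp.memLp Y).1.prodMk_left] with ω hω hmeas
  exact (memLp_two_iff_integrable_sq_norm hmeas).2 hω

theorem HasSections.of_tendsto_Lp [IsFiniteMeasure μ] {U : ℕ → Lp ℂ 2 (μ.prod m)}
    {Y : Lp ℂ 2 (μ.prod m)} {f : ℕ → Ω → Lp ℂ 2 m} {g : Ω → Lp ℂ 2 m}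
    (hU : ∀ n, HasSections (U n).1 (f n)) (hY : Tendsto U atTop (𝓝 Y))
    (hg : ∀ᵐ ω ∂μ, Tendsto (fun n => f n ω) atTop (𝓝 (g ω))) : HasSections Y.1 g := by
  have hsub n := (hU n).sub (hasSections_sec_of_L2 Y)
  have hnorm : Tendsto (fun n => eLpNorm (fun ω => ‖f n ω - sec Y.1 ω‖) 2 μ) atTop (𝓝 0) := by
    refine ((Lp.tendsto_Lp_iff_tendsto_eLpNorm' U Y).1 hY).congr fun n => ?_
    rw [eLpNorm_norm, ← (hsub n).eLpNorm_eq]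
    exact (eLpNorm_congr_ae (AEEqFun.coeFn_sub _ _)).symm
  obtain ⟨φ, hφ, hlim⟩ := (tendstoInMeasure_of_tendsto_eLpNorm (g := 0) two_ne_zero
    (fun n => (hsub n).aestronglyMeasurable_norm) aestronglyMeasurable_zero
    (by simpa using hnorm)).exists_seq_tendsto_ae
  refine (hasSections_sec_of_L2 Y).congr ?_
  filter_upwards [hlim, hg] with ω h0 hgω
  exact tendsto_nhds_unique (tendsto_iff_norm_sub_tendsto_zero.2 h0)
    (hgω.comp hφ.tendsto_atTop)

theorem cauchySeq_of_sections [IsFiniteMeasure μ] {U : ℕ → Lp ℂ 2 (μ.prod m)} {C : ℝ}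
    {f : ℕ → Ω → Lp ℂ 2 m} {g : Ω → Lp ℂ 2 m} (hU : ∀ n, HasSections (U n).1 (f n))
    (hC : ∀ n, ∀ᵐ ω ∂μ, ‖f n ω‖ ≤ C)
    (hg : ∀ᵐ ω ∂μ, Tendsto (fun n => f n ω) atTop (𝓝 (g ω))) : CauchySeq U := by
  have hsub (p : ℕ × ℕ) := (hU p.1).sub (hU p.2)
  have hnorm : Tendsto (fun p : ℕ × ℕ => eLpNorm (fun ω => f p.1 ω - f p.2 ω) 2 μ) atTop
      (𝓝 0) := by
    refine tendsto_eLpNorm_zero_of_ae_norm_le two_ne_zero ENNReal.ofNat_ne_top (C := C + C)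
      (fun p => (hsub p).aestronglyMeasurable_norm) (fun p => ?_) ?_
    · filter_upwards [hC p.1, hC p.2] with ω h1 h2
      exact (norm_sub_le _ _).trans (add_le_add h1 h2)
    · filter_upwards [hg] with ω hω
      rw [← sub_self (g ω), ← prod_atTop_atTop_eq]
      exact (hω.comp tendsto_fst).sub (hω.comp tendsto_snd)
  rw [cauchySeq_iff_tendsto_dist_atTop_0]
  refine ((ENNReal.tendsto_toReal ENNReal.zero_ne_top).comp hnorm).congr fun p => ?_
  rw [Function.comp_apply, ← (hsub p).eLpNorm_eq, dist_eq_norm]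
  rfl

theorem exists_hasSections_of_tendsto_of_norm_le_const [IsFiniteMeasure μ]
    {u : ℕ → Ω × S →ₘ[μ.prod m] ℂ} {f : ℕ → Ω → Lp ℂ 2 m} {g : Ω → Lp ℂ 2 m} {C : ℝ}
    (hu : ∀ n, HasSections (u n) (f n)) (hC : ∀ n, ∀ᵐ ω ∂μ, ‖f n ω‖ ≤ C)
    (hg : ∀ᵐ ω ∂μ, Tendsto (fun n => f n ω) atTop (𝓝 (g ω))) :
    ∃ v : Ω × S →ₘ[μ.prod m] ℂ, HasSections v g := by
  have hmem n : u n ∈ Lp ℂ 2 (μ.prod m) := by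
    rw [Lp.mem_Lp_iff_eLpNorm_lt_top, (hu n).eLpNorm_eq, ← eLpNorm_norm]
    exact (MemLp.of_bound (hu n).aestronglyMeasurable_norm C
      ((hC n).mono fun ω hω => by rwa [norm_norm])).2
  obtain ⟨Y, hY⟩ := cauchySeq_tendsto_of_complete
    (cauchySeq_of_sections (U := fun n => ⟨u n, hmem n⟩) hu hC hg)
  exact ⟨Y.1, .of_tendsto_Lp hu hY hg⟩

/-- Dividing by `1 + ‖x‖` reduces to uniformly bounded sections. -/
theorem exists_hasSections_of_tendsto_of_norm_le [IsFiniteMeasure μ] {q : ℝ≥0∞} (x : L22 μ m q)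
    {u : ℕ → Ω × S →ₘ[μ.prod m] ℂ} {f : ℕ → Ω → Lp ℂ 2 m} {g : Ω → Lp ℂ 2 m} {M : ℝ}
    (hM : 0 ≤ M) (hu : ∀ n, HasSections (u n) (f n))
    (hx : ∀ n, ∀ᵐ ω ∂μ, ‖f n ω‖ ≤ M * ‖sec x.1 ω‖)
    (hg : ∀ᵐ ω ∂μ, Tendsto (fun n => f n ω) atTop (𝓝 (g ω))) :
    ∃ z : L22 μ m q, HasSections z.1 g := by
  have hxs := hasSections_sec x
  have hφ : Measurable fun r : ℝ => 1 + r := by fun_prop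
  have hφ' : Measurable fun r : ℝ => (1 + r)⁻¹ := by fun_prop
  obtain ⟨v, hv⟩ := exists_hasSections_of_tendsto_of_norm_le_const (C := M)
    (g := fun ω => (((1 + ‖sec x.1 ω‖)⁻¹ : ℝ) : ℂ) • g ω)
    (fun n => hxs.smul_norm hφ' (hu n))
    (fun n => by
      filter_upwards [hx n] with ω hω
      rw [norm_smul, Complex.norm_real, Real.norm_of_nonneg (by positivity),
        inv_mul_le_iff₀ (by positivity)]
      refine hω.trans ?_
      linarith)
    (hg.mono fun ω hω => hω.const_smul _)
  have hag := (hxs.smul_norm hφ hv).congr (g := g)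
    (.of_forall fun ω => by
      rw [smul_smul, ← Complex.ofReal_mul, mul_inv_cancel₀ (by positivity),
        Complex.ofReal_one, one_smul])
  refine ⟨⟨_, hag.mem_of_norm_le hxs (C := M) ?_⟩, hag⟩
  filter_upwards [ae_all_iff.2 hx, hg] with ω h h'
  exact le_of_tendsto h'.norm (.of_forall h)

end Gluing

section Glued

variable {Ω S : Type*} [MeasurableSpace Ω] [MeasurableSpace S] {μ : Measure Ω} {m : Measure S}
  [IsFiniteMeasure m] {q : ℝ≥0∞}

theorem exists_decomposes_ofReal_smul_one {φ : ℝ → ℝ} (hφ : Measurable φ) {M : ℝ}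
    (hM : ∀ r, |φ r| ≤ M) (l : Ω →ₘ[μ] ℝ) :
    ∃ A : Module.End ℂ (L22 μ m q), Decomposes A (fun ω => (φ (l ω) : ℂ) • 1) ∧
      ∀ C : Module.End ℂ (L22 μ m q), IsL0Linear C → Commute C A := by
  have hl := coeFn_toComplex_compMeasurable hφ l
  have hbound : ∃ M : ℝ, ∀ᵐ ω ∂μ, ‖toComplex (AEEqFun.compMeasurable φ hφ l) ω‖ ≤ M := by
    refine ⟨M, hl.mono fun ω hω => ?_⟩
    rw [hω, Complex.norm_real]
    exact hM _
  refine ⟨boundedMul q _ hbound, (Decomposes.boundedMul _ hbound).congr ?_,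
    fun C hC => LinearMap.ext fun x => Subtype.ext (hC _ x _ rfl)⟩
  exact hl.mono fun ω hω => by rw [hω]

theorem exists_decomposes_rescale {T : L22 μ m q →ₗ[ℂ] L22 μ m q}
    {t : Ω → Lp ℂ 2 m →L[ℂ] Lp ℂ 2 m} (hT : Decomposes T t) {N : ℝ} (hN : 0 ≤ N)
    (l : Ω →ₘ[μ] ℝ) :
    ∃ A : Module.End ℂ (L22 μ m q), Decomposes A (fun ω => rescale N (t ω) (l ω)) ∧
      ∀ C : Module.End ℂ (L22 μ m q), IsL0Linear C → C ∘ₗ T = T ∘ₗ C → Commute C A := by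
  have hpos (r : ℝ) : 0 < N + |r| + 1 := by positivity
  obtain ⟨a, ha, hCa⟩ := exists_decomposes_ofReal_smul_one (m := m) (q := q)
    (φ := fun r => (N + |r| + 1)⁻¹) (by fun_prop) (M := 1) (fun r => by
      rw [abs_inv, abs_of_pos (hpos r)]
      exact inv_le_one_of_one_le₀ (by linarith [abs_nonneg r])) l
  obtain ⟨b, hb, hCb⟩ := exists_decomposes_ofReal_smul_one (m := m) (q := q)
    (φ := fun r => (N + |r| + 1)⁻¹ * -r) (by fun_prop) (M := 1) (fun r => by
      rw [abs_mul, abs_inv, abs_of_pos (hpos r), abs_neg, inv_mul_le_one₀ (hpos r)]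
      linarith) l
  refine ⟨a * T + b, ((ha.mul hT).add hb).congr (.of_forall fun ω => ?_),
    fun C hC hCT => ((hCa C hC).mul_right hCT).add_right (hCb C hC)⟩
  rw [rescale, smul_mul_assoc, one_mul, Complex.ofReal_mul, Complex.ofReal_neg, mul_neg, neg_smul,
    mul_smul, smul_sub, sub_eq_add_neg]

theorem exists_decomposes_of_forall_exists {b : Ω → Lp ℂ 2 m →L[ℂ] Lp ℂ 2 m}
    (h : ∀ x : L22 μ m q, ∃ z : L22 μ m q, HasSections z.1 fun ω => b ω (sec x.1 ω)) :
    ∃ B : L22 μ m q →ₗ[ℂ] L22 μ m q, Decomposes B b := by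
  choose B hB using h
  refine ⟨{ toFun := B, map_add' := fun x y => ?_, map_smul' := fun c x => ?_ }, hB⟩
  · refine ((hB (x + y)).congr ?_).l22_ext ((hB x).add (hB y))
    filter_upwards [sec_add x y] with ω h
    rw [h, map_add]
  · refine ((hB (c • x)).congr ?_).l22_ext ((hB x).smul c)
    filter_upwards [sec_smul c x] with ω h
    rw [h, map_smul]

theorem norm_inv_norm_smul_le_one {E : Type*} [NormedAddCommGroup E] [NormedSpace ℂ E] (v : E) :
    ‖((‖v‖⁻¹ : ℝ) : ℂ) • v‖ ≤ 1 := by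
  rw [norm_smul, Complex.norm_real, norm_inv, norm_norm]
  exact inv_mul_le_one

theorem exists_hasSections_inv_norm_smul [IsFiniteMeasure μ] (x : L22 μ m q) :
    ∃ u : L22 μ m q,
      HasSections u.1 fun ω => ((‖sec x.1 ω‖⁻¹ : ℝ) : ℂ) • sec x.1 ω := by
  have hx := hasSections_sec x
  have hu := hx.smul_norm measurable_inv hx
  exact ⟨⟨_, hu.mem_of_norm_le_const (.of_forall fun ω => norm_inv_norm_smul_le_one _)⟩, hu⟩

theorem exists_norm_le_mul [IsFiniteMeasure μ] {C : L22 μ m q →ₗ[ℂ] L22 μ m q}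
    (hC : IsL0Linear C) (hb : IsL0Bounded C) :
    ∃ c : Ω →ₘ[μ] ℝ, ∀ x : L22 μ m q, ∀ᵐ ω ∂μ, ‖sec (C x).1 ω‖ ≤ ‖sec x.1 ω‖ * c ω := by
  obtain ⟨c, hc⟩ := hb {x | norm₀ x.1 ≤ 1} ⟨1, by rintro _ ⟨x, hx, rfl⟩; exact hx⟩
  refine ⟨c, fun x => ?_⟩
  have hx := hasSections_sec x
  obtain ⟨u, hu⟩ := exists_hasSections_inv_norm_smul x
  have hu_norm : norm₀ u.1 ≤ 1 := by
    rw [← AEEqFun.coeFn_le]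
    filter_upwards [hu.norm₀, AEEqFun.coeFn_one (μ := μ) (β := ℝ)] with ω h1 h2
    rw [h1, h2]
    exact norm_inv_norm_smul_le_one _
  have hCu : norm₀ (C u).1 ≤ c := hc ⟨_, ⟨u, hu_norm, rfl⟩, rfl⟩
  have hcoe : ∀ᵐ ω ∂μ, toComplex (norm₀ x.1) ω = (‖sec x.1 ω‖ : ℂ) := by
    filter_upwards [coeFn_toComplex (norm₀ x.1), hx.norm₀] with ω h1 h2
    rw [h1, h2]
  have hxu : x.1 = scalarMul μ m (toComplex (norm₀ x.1)) u := by
    refine hx.ext ((hu.scalarMul _).congr (hcoe.mono fun ω hω => ?_))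
    rw [hω, smul_smul, ← Complex.ofReal_mul]
    by_cases h0 : sec x.1 ω = 0
    · rw [h0, smul_zero]
    · rw [mul_inv_cancel₀ (norm_ne_zero_iff.2 h0), Complex.ofReal_one, one_smul]
  have hCx : HasSections (C x).1 fun ω => toComplex (norm₀ x.1) ω • sec (C u).1 ω := by
    rw [hC _ u x hxu]
    exact (hasSections_sec (C u)).scalarMul _
  filter_upwards [hCx.sec_eq, hcoe, (hasSections_sec (C u)).norm₀, AEEqFun.coeFn_le.2 hCu]
    with ω h1 h2 h3 h4
  rw [h1, norm_smul, h2, Complex.norm_real, norm_norm, ← h3]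
  gcongr

theorem tendsto_sec_apply [IsFiniteMeasure μ] {C : L22 μ m q →ₗ[ℂ] L22 μ m q}
    (hC : IsL0Linear C) (hb : IsL0Bounded C) {y : ℕ → L22 μ m q} {z : L22 μ m q}
    (h : ∀ᵐ ω ∂μ, Tendsto (fun n => sec (y n).1 ω) atTop (𝓝 (sec z.1 ω))) :
    ∀ᵐ ω ∂μ, Tendsto (fun n => sec (C (y n)).1 ω) atTop (𝓝 (sec (C z).1 ω)) := by
  obtain ⟨c, hc⟩ := exists_norm_le_mul hC hb
  have hle := ae_all_iff.2 fun n => hc (y n - z)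
  have hsub := ae_all_iff.2 fun n => sec_sub (y n) z
  have hsubC := ae_all_iff.2 fun n => sec_sub (C (y n)) (C z)
  filter_upwards [h, hle, hsub, hsubC] with ω h hle hsub hsubC
  rw [tendsto_iff_norm_sub_tendsto_zero] at h ⊢
  have hlim := h.mul_const (c ω)
  rw [zero_mul] at hlim
  refine squeeze_zero (fun n => norm_nonneg _) (fun n => ?_) hlim
  have hmap : C (y n - z) = C (y n) - C z := map_sub C _ _
  rw [← hsub, ← hsubC, ← hmap]
  exact hle n

theorem commute_of_forall_tendsto [IsFiniteMeasure μ] {E : L22 μ m q →ₗ[ℂ] L22 μ m q}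
    {e : Ω → Lp ℂ 2 m →L[ℂ] Lp ℂ 2 m} (hE : Decomposes E e) {A : ℕ → Module.End ℂ (L22 μ m q)}
    (hA : ∀ x, ∀ᵐ ω ∂μ, Tendsto (fun n => sec (A n x).1 ω) atTop (𝓝 (e ω (sec x.1 ω))))
    {C : Module.End ℂ (L22 μ m q)} (hC : IsL0Linear C) (hb : IsL0Bounded C)
    (hCA : ∀ n, Commute C (A n)) : Commute E C := by
  refine LinearMap.ext fun x => ?_
  have hlim : ∀ᵐ ω ∂μ, Tendsto (fun n => sec (C (A n x)).1 ω) atTop (𝓝 (sec (C (E x)).1 ω)) := by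
    refine tendsto_sec_apply hC hb ?_
    filter_upwards [hA x, (hE x).sec_eq] with ω h1 h2
    rwa [h2]
  have hcomm (n) : C (A n x) = A n (C x) := LinearMap.congr_fun (hCA n).eq x
  simp only [hcomm] at hlim
  refine (hE (C x)).l22_ext ((hasSections_sec (C (E x))).congr ?_)
  filter_upwards [hlim, hA (C x)] with ω h1 h2
  exact tendsto_nhds_unique h1 h2

theorem exists_glued_spectralProjection [IsFiniteMeasure μ] {T : L22 μ m q →ₗ[ℂ] L22 μ m q}
    {t : Ω → Lp ℂ 2 m →L[ℂ] Lp ℂ 2 m} (hT : Decomposes T t)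
    (ht : ∀ᵐ ω ∂μ, IsCompactSymmetric (t ω)) {N : ℝ} (hN : 0 ≤ N) (htN : ∀ᵐ ω ∂μ, ‖t ω‖ ≤ N)
    (l : Ω →ₘ[μ] ℝ) :
    ∃ E : L22 μ m q →ₗ[ℂ] L22 μ m q, Decomposes E (fun ω => spectralProjection (t ω) (l ω)) ∧
      ∀ C : L22 μ m q →ₗ[ℂ] L22 μ m q, IsL0Linear C → IsL0Bounded C → C ∘ₗ T = T ∘ₗ C →
        E ∘ₗ C = C ∘ₗ E := by
  obtain ⟨A, hA, hCA⟩ := exists_decomposes_rescale hT hN l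
  obtain ⟨p, hp⟩ := exists_polynomial_tendsto_indicator
  have hlim (x : L22 μ m q) : ∀ᵐ ω ∂μ, Tendsto (fun n => aeval (rescale N (t ω) (l ω)) (p n)
      (sec x.1 ω)) atTop (𝓝 (spectralProjection (t ω) (l ω) (sec x.1 ω))) := by
    filter_upwards [ht, htN] with ω h hN
    exact h.tendsto_aeval_rescale_apply hN hp _ _
  obtain ⟨E, hE⟩ := exists_decomposes_of_forall_exists fun x : L22 μ m q =>
    exists_hasSections_of_tendsto_of_norm_le x zero_le_two (fun n => hA.aeval (p n) x)
      (fun n => by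
        filter_upwards [ht, htN] with ω h hN
        exact h.norm_aeval_rescale_apply_le hN (fun r hr => (hp r hr).1 n) _ _) (hlim x)
  refine ⟨E, hE, fun C hC hb hCT => commute_of_forall_tendsto hE (A := fun n => aeval A (p n))
    (fun x => ?_) hC hb fun n => ?_⟩
  · filter_upwards [hlim x, ae_all_iff.2 fun n => (hA.aeval (p n) x).sec_eq] with ω h1 h2
    simpa only [h2] using h1
  · exact Algebra.commute_of_mem_adjoin_singleton_of_commute (aeval_mem_adjoin_singleton ℝ A)
      (hCA C hC hCT)

end Glued

/-! ### Order completeness of `L₀ʰ(Ω)` -/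

section Order

variable {Ω : Type*} [MeasurableSpace Ω] {μ : Measure Ω}

theorem exists_isLUB_tendsto_of_monotone {u : ℕ → Ω →ₘ[μ] ℝ} (hu : Monotone u)
    (hb : BddAbove (Set.range u)) :
    ∃ g : Ω →ₘ[μ] ℝ, IsLUB (Set.range u) g ∧
      ∀ᵐ ω ∂μ, Tendsto (fun n => u n ω) atTop (𝓝 (g ω)) := by
  obtain ⟨b, hb⟩ := hb
  have hmono : ∀ᵐ ω ∂μ, Monotone fun n => u n ω :=
    (ae_all_iff.2 fun n => AEEqFun.coeFn_le.2 (hu (Nat.le_succ n))).mono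
      fun ω hω => monotone_nat_of_le_succ hω
  have hbdd : ∀ᵐ ω ∂μ, BddAbove (Set.range fun n => u n ω) :=
    (ae_all_iff.2 fun n => AEEqFun.coeFn_le.2 (hb ⟨n, rfl⟩)).mono
      fun ω hω => ⟨b ω, Set.forall_mem_range.2 hω⟩
  have hg : AEStronglyMeasurable (fun ω => ⨆ n, u n ω) μ :=
    (AEMeasurable.iSup fun n => (u n).aemeasurable).aestronglyMeasurable
  refine ⟨AEEqFun.mk _ hg, ⟨?_, fun w hw => ?_⟩, ?_⟩
  · rintro _ ⟨n, rfl⟩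
    rw [← AEEqFun.coeFn_le]
    filter_upwards [hbdd, AEEqFun.coeFn_mk _ hg] with ω h1 h2
    rw [h2]
    exact le_ciSup h1 n
  · rw [← AEEqFun.coeFn_le]
    filter_upwards [AEEqFun.coeFn_mk _ hg,
      ae_all_iff.2 fun n => AEEqFun.coeFn_le.2 (hw ⟨n, rfl⟩)] with ω h1 h2
    rw [h1]
    exact ciSup_le h2
  · filter_upwards [hmono, hbdd, AEEqFun.coeFn_mk _ hg] with ω h1 h2 h3
    rw [h3]
    exact tendsto_atTop_ciSup h1 h2

theorem exists_seq_strictlyBelow_tendsto (l : Ω →ₘ[μ] ℝ) :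
    ∃ u : ℕ → Ω →ₘ[μ] ℝ, (∀ n, StrictlyBelow (u n) l) ∧
      ∀ᵐ ω ∂μ, Tendsto (fun n => u n ω) atTop (𝓝 (l ω)) := by
  have hφ (n : ℕ) : Continuous fun r : ℝ => r - 1 / ((n : ℝ) + 1) := by fun_prop
  have hu (n : ℕ) := AEEqFun.coeFn_comp _ (hφ n) l
  refine ⟨fun n => AEEqFun.comp _ (hφ n) l, fun n => ?_, ?_⟩
  · filter_upwards [hu n] with ω hω
    rw [hω, Function.comp_apply, sub_lt_self_iff]
    positivity
  · filter_upwards [ae_all_iff.2 hu] with ω hω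
    simp only [hω, Function.comp_apply]
    simpa using tendsto_const_nhds.sub (tendsto_one_div_add_atTop_nhds_zero_nat (𝕜 := ℝ))

theorem abs_arctan_le_pi_div_two (r : ℝ) : |Real.arctan r| ≤ Real.pi / 2 :=
  abs_le.2 ⟨(Real.neg_pi_div_two_lt_arctan r).le, (Real.arctan_lt_pi_div_two r).le⟩

/-- The integral of `arctan f`: on a finite measure space, a strictly monotone functional defined
on all of `L₀ʰ(Ω)`. -/
def integralArctan (f : Ω →ₘ[μ] ℝ) : ℝ := ∫ ω, Real.arctan (f ω) ∂μ

variable [IsFiniteMeasure μ]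

theorem integrable_arctan (f : Ω →ₘ[μ] ℝ) : Integrable (fun ω => Real.arctan (f ω)) μ :=
  .of_bound (Real.continuous_arctan.comp_aestronglyMeasurable f.aestronglyMeasurable)
    (Real.pi / 2) (.of_forall fun _ => abs_arctan_le_pi_div_two _)

theorem monotone_integralArctan : Monotone (integralArctan : (Ω →ₘ[μ] ℝ) → ℝ) := fun f g h =>
  integral_mono_ae (integrable_arctan f) (integrable_arctan g)
    ((AEEqFun.coeFn_le.2 h).mono fun _ hω => Real.arctan_strictMono.monotone hω)

theorem eq_of_le_of_integralArctan_le {f g : Ω →ₘ[μ] ℝ} (h : f ≤ g)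
    (hgf : integralArctan g ≤ integralArctan f) : f = g := by
  have hae := (integral_eq_iff_of_ae_le (integrable_arctan f) (integrable_arctan g)
    ((AEEqFun.coeFn_le.2 h).mono fun _ hω => Real.arctan_strictMono.monotone hω)).1
    (le_antisymm (monotone_integralArctan h) hgf)
  exact AEEqFun.ext (hae.mono fun _ hω => Real.arctan_injective hω)

theorem tendsto_integralArctan {u : ℕ → Ω →ₘ[μ] ℝ} {f : Ω →ₘ[μ] ℝ}
    (h : ∀ᵐ ω ∂μ, Tendsto (fun n => u n ω) atTop (𝓝 (f ω))) :
    Tendsto (fun n => integralArctan (u n)) atTop (𝓝 (integralArctan f)) :=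
  tendsto_integral_of_dominated_convergence (fun _ => Real.pi / 2)
    (fun n => (integrable_arctan (u n)).1) (integrable_const _)
    (fun _ => .of_forall fun _ => abs_arctan_le_pi_div_two _)
    (h.mono fun _ hω => (Real.continuous_arctan.tendsto _).comp hω)

theorem exists_isLUB_of_supClosed {R : Set (Ω →ₘ[μ] ℝ)} (hne : R.Nonempty) (hb : BddAbove R)
    (hR : SupClosed R) : ∃ g, IsLUB R g := by
  have hJb : BddAbove (integralArctan '' R) := monotone_integralArctan.map_bddAbove hb
  obtain ⟨_, -, hJ, hmem⟩ := exists_seq_tendsto_sSup (hne.image integralArctan) hJb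
  choose f hfR hfJ using hmem
  obtain rfl := funext hfJ
  have huR n : partialSups f n ∈ R := hR.finsetSup'_mem Finset.nonempty_Iic fun i _ => hfR i
  obtain ⟨g, hg, hlim⟩ := exists_isLUB_tendsto_of_monotone (partialSups f).monotone
    (hb.mono (Set.range_subset_iff.2 huR))
  have hsup : sSup (integralArctan '' R) ≤ integralArctan g :=
    le_of_tendsto_of_tendsto' hJ (tendsto_integralArctan hlim) fun n =>
      monotone_integralArctan (le_partialSups f n)
  refine ⟨g, fun w hw => ?_, fun z hz => hg.2 fun _ hu => ?_⟩
  · have hlim_sup : ∀ᵐ ω ∂μ, Tendsto (fun n => (partialSups f n ⊔ w) ω) atTop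
        (𝓝 ((g ⊔ w) ω)) := by
      filter_upwards [hlim, AEEqFun.coeFn_sup g w,
        ae_all_iff.2 fun n => AEEqFun.coeFn_sup (partialSups f n) w] with ω h1 h2 h3
      simp only [h2, h3]
      exact h1.sup_nhds tendsto_const_nhds
    have hle : integralArctan (g ⊔ w) ≤ sSup (integralArctan '' R) :=
      le_of_tendsto' (tendsto_integralArctan hlim_sup) fun n =>
        le_csSup hJb ⟨_, hR (huR n) hw, rfl⟩
    rw [eq_of_le_of_integralArctan_le le_sup_left (hle.trans hsup)]
    exact le_sup_right
  · obtain ⟨n, rfl⟩ := hu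
    exact hz (huR n)

theorem exists_isLUB {R : Set (Ω →ₘ[μ] ℝ)} (hne : R.Nonempty) (hb : BddAbove R) :
    ∃ g, IsLUB R g := by
  obtain ⟨g, hg⟩ := exists_isLUB_of_supClosed (R := supClosure R)
    (hne.mono subset_supClosure) (by rwa [BddAbove, upperBounds_supClosure])
    supClosed_supClosure
  exact ⟨g, isLUB_supClosure.1 hg⟩

theorem exists_isGLB {R : Set (Ω →ₘ[μ] ℝ)} (hne : R.Nonempty) (hb : BddBelow R) :
    ∃ g, IsGLB R g := by
  obtain ⟨g, hg⟩ := exists_isLUB hb hne.bddAbove_lowerBounds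
  exact ⟨g, isLUB_lowerBounds.1 hg⟩

end Order

section RealPart

variable {Ω : Type*} [MeasurableSpace Ω] {μ : Measure Ω}

theorem toComplex_le_iff {f g : Ω →ₘ[μ] ℝ} : toComplex f ≤ toComplex g ↔ f ≤ g := by
  rw [← AEEqFun.coeFn_le, ← AEEqFun.coeFn_le]
  refine eventually_congr ?_
  filter_upwards [coeFn_toComplex f, coeFn_toComplex g] with ω hf hg
  rw [hf, hg, Complex.real_le_real]

theorem mem_range_toComplex_iff {w : Ω →ₘ[μ] ℂ} :
    w ∈ Set.range toComplex ↔ ∀ᵐ ω ∂μ, (w ω).im = 0 := by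
  constructor
  · rintro ⟨f, rfl⟩
    exact (coeFn_toComplex f).mono fun ω hω => by rw [hω, Complex.ofReal_im]
  · refine fun h => ⟨AEEqFun.comp _ Complex.continuous_re w, AEEqFun.ext ?_⟩
    filter_upwards [h, coeFn_toComplex (AEEqFun.comp _ Complex.continuous_re w),
      AEEqFun.coeFn_comp _ Complex.continuous_re w] with ω h1 h2 h3
    rw [h2, h3]
    exact Complex.ext rfl h1.symm

theorem mem_range_toComplex_congr_of_le {w w' : Ω →ₘ[μ] ℂ} (h : w ≤ w') :
    w ∈ Set.range toComplex ↔ w' ∈ Set.range toComplex := by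
  rw [mem_range_toComplex_iff, mem_range_toComplex_iff]
  exact eventually_congr
    ((AEEqFun.coeFn_le.2 h).mono fun ω hω => by rw [(Complex.le_def.1 hω).2])

theorem isGLB_toComplex_image {R : Set (Ω →ₘ[μ] ℝ)} (hne : R.Nonempty) {g : Ω →ₘ[μ] ℝ}
    (hg : IsGLB R g) : IsGLB (toComplex '' R) (toComplex g) := by
  refine ⟨Set.forall_mem_image.2 fun f hf => toComplex_le_iff.2 (hg.1 hf), fun w hw => ?_⟩
  rw [mem_lowerBounds, Set.forall_mem_image] at hw
  obtain ⟨f, hf⟩ := hne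
  obtain ⟨w, rfl⟩ := (mem_range_toComplex_congr_of_le (hw hf)).2 ⟨f, rfl⟩
  exact toComplex_le_iff.2 (hg.2 fun f hf => toComplex_le_iff.1 (hw hf))

theorem isLUB_toComplex_image {R : Set (Ω →ₘ[μ] ℝ)} (hne : R.Nonempty) {g : Ω →ₘ[μ] ℝ}
    (hg : IsLUB R g) : IsLUB (toComplex '' R) (toComplex g) := by
  refine ⟨Set.forall_mem_image.2 fun f hf => toComplex_le_iff.2 (hg.1 hf), fun w hw => ?_⟩
  rw [mem_upperBounds, Set.forall_mem_image] at hw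
  obtain ⟨f, hf⟩ := hne
  obtain ⟨w, rfl⟩ := (mem_range_toComplex_congr_of_le (hw hf)).1 ⟨f, rfl⟩
  exact toComplex_le_iff.2 (hg.2 fun f hf => toComplex_le_iff.1 (hw hf))

theorem exists_isGLB_isLUB_toComplex [IsFiniteMeasure μ] {Z : Set (Ω →ₘ[μ] ℂ)} (hne : Z.Nonempty)
    (hZ : Z ⊆ Set.range toComplex) {N : ℝ} (hN : ∀ z ∈ Z, ∀ᵐ ω ∂μ, ‖z ω‖ ≤ N) :
    ∃ lo hi : Ω →ₘ[μ] ℝ, IsGLB Z (toComplex lo) ∧ IsLUB Z (toComplex hi) := by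
  obtain ⟨R, rfl⟩ := Set.subset_range_iff_exists_image_eq.1 hZ
  have hR : R.Nonempty := hne.of_image
  have hbd : ∀ f ∈ R, ∀ᵐ ω ∂μ, |f ω| ≤ N := by
    intro f hf
    filter_upwards [hN _ ⟨f, hf, rfl⟩, coeFn_toComplex f] with ω h1 h2
    rwa [h2, Complex.norm_real] at h1
  have hbelow : BddBelow R := by
    refine ⟨AEEqFun.const Ω (-N), fun f hf => ?_⟩
    rw [← AEEqFun.coeFn_le]
    filter_upwards [hbd f hf, AEEqFun.coeFn_const (μ := μ) Ω (-N)] with ω h1 h2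
    exact h2.trans_le (abs_le.1 h1).1
  have habove : BddAbove R := by
    refine ⟨AEEqFun.const Ω N, fun f hf => ?_⟩
    rw [← AEEqFun.coeFn_le]
    filter_upwards [hbd f hf, AEEqFun.coeFn_const (μ := μ) Ω N] with ω h1 h2
    exact (abs_le.1 h1).2.trans_eq h2.symm
  obtain ⟨lo, hlo⟩ := exists_isGLB hR hbelow
  obtain ⟨hi, hhi⟩ := exists_isLUB hR habove
  exact ⟨lo, hi, isGLB_toComplex_image hR hlo, isLUB_toComplex_image hR hhi⟩

end RealPart

/-! ### The numerical range -/

section NumericalRange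

variable {Ω S : Type*} [MeasurableSpace Ω] [MeasurableSpace S] {μ : Measure Ω} {m : Measure S}
  [IsFiniteMeasure m]

theorem exists_hasSections_const_norm_eq_one (μ : Measure Ω) (hS : m ≠ 0) :
    ∃ (u : Ω × S →ₘ[μ.prod m] ℂ) (e : Lp ℂ 2 m), ‖e‖ = 1 ∧ HasSections u fun _ => e := by
  have : NeZero m := ⟨hS⟩
  have hm : 0 < m.real Set.univ := measureReal_univ_pos
  set c : ℂ := (((Real.sqrt (m.real Set.univ))⁻¹ : ℝ) : ℂ) with hc
  have hcm : MemLp (fun _ : S => c) 2 m := memLp_const c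
  have hc_norm : ‖c‖ ^ 2 = (m.real Set.univ)⁻¹ := by
    rw [hc, Complex.norm_real, norm_inv, Real.norm_eq_abs, inv_pow, sq_abs, Real.sq_sqrt hm.le]
  have hnorm : ‖hcm.toLp‖ ^ 2 = 1 := by
    rw [norm_toLp_sq_eq_integral hcm, integral_const, smul_eq_mul, hc_norm,
      mul_inv_cancel₀ hm.ne']
  refine ⟨AEEqFun.const _ c, hcm.toLp,
    (pow_eq_one_iff_of_nonneg (norm_nonneg _) two_ne_zero).1 hnorm, ?_⟩
  filter_upwards [Measure.ae_ae_of_ae_prod (AEEqFun.coeFn_const (μ := μ.prod m) (Ω × S) c)]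
    with ω hω
  exact EventuallyEq.trans hω hcm.coeFn_toLp.symm

variable {q : ℝ≥0∞} {T : L22 μ m q →ₗ[ℂ] L22 μ m q} {t : Ω → Lp ℂ 2 m →L[ℂ] Lp ℂ 2 m}

theorem ae_norm_sec_eq_one {u : L22 μ m q} (hu : norm₀ u.1 = 1) :
    ∀ᵐ ω ∂μ, ‖sec u.1 ω‖ = 1 := by
  filter_upwards [(hasSections_sec u).norm₀, AEEqFun.coeFn_one (μ := μ) (β := ℝ)] with ω h1 h2
  rw [← h1, hu, h2, Pi.one_apply]

theorem Decomposes.inner₀_apply_self (hT : Decomposes T t) (x : L22 μ m q) :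
    ∀ᵐ ω ∂μ, inner₀ (T x).1 x.1 ω = ⟪sec x.1 ω, t ω (sec x.1 ω)⟫_ℂ :=
  (hT x).inner₀ (hasSections_sec x)

theorem numericalRange_subset_range_toComplex (hT : Decomposes T t)
    (ht : ∀ᵐ ω ∂μ, (t ω : Lp ℂ 2 m →ₗ[ℂ] Lp ℂ 2 m).IsSymmetric) :
    numericalRange T ⊆ Set.range toComplex := by
  rintro _ ⟨x, -, rfl⟩
  rw [mem_range_toComplex_iff]
  filter_upwards [hT.inner₀_apply_self x, ht] with ω h1 h2
  rw [h1, ← Complex.conj_eq_iff_im, inner_conj_symm]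
  exact h2 _ _

theorem norm_le_of_mem_numericalRange (hT : Decomposes T t) {N : ℝ} (hN : ∀ᵐ ω ∂μ, ‖t ω‖ ≤ N) :
    ∀ z ∈ numericalRange T, ∀ᵐ ω ∂μ, ‖z ω‖ ≤ N := by
  rintro _ ⟨x, hx, rfl⟩
  filter_upwards [hT.inner₀_apply_self x, ae_norm_sec_eq_one hx, hN] with ω h1 h2 h3
  rw [h1]
  refine (norm_inner_le_norm _ _).trans ?_
  simpa only [h2, one_mul, mul_one] using (t ω).le_of_opNorm_le h3 (sec x.1 ω)

variable [IsFiniteMeasure μ]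

theorem exists_norm_eq_one_sec_eq_smul (hS : m ≠ 0) (y : L22 μ m q) :
    ∃ u : L22 μ m q, norm₀ u.1 = 1 ∧
      ∀ᵐ ω ∂μ, sec y.1 ω = (‖sec y.1 ω‖ : ℂ) • sec u.1 ω := by
  obtain ⟨v, e, he, hv⟩ := exists_hasSections_const_norm_eq_one μ hS
  obtain ⟨w, hw⟩ := exists_hasSections_inv_norm_smul y
  have hφ : Measurable fun r : ℝ => if r = 0 then (1 : ℝ) else 0 :=
    Measurable.ite (measurableSet_singleton 0) measurable_const measurable_const
  have hu := hw.add ((hasSections_sec y).smul_norm hφ hv)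
  have hnorm (ω : Ω) : ‖((‖sec y.1 ω‖⁻¹ : ℝ) : ℂ) • sec y.1 ω +
      ((if ‖sec y.1 ω‖ = 0 then (1 : ℝ) else 0 : ℝ) : ℂ) • e‖ = 1 := by
    by_cases h0 : sec y.1 ω = 0
    · simp [h0, he]
    · have h0' := norm_ne_zero_iff.2 h0
      rw [if_neg h0', Complex.ofReal_zero, zero_smul, add_zero, norm_smul, Complex.norm_real,
        norm_inv, norm_norm, inv_mul_cancel₀ h0']
  refine ⟨⟨_, hu.mem_of_norm_le_const (.of_forall fun ω => (hnorm ω).le)⟩, AEEqFun.ext ?_, ?_⟩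
  · filter_upwards [hu.norm₀, AEEqFun.coeFn_one (μ := μ) (β := ℝ)] with ω h1 h2
    rw [h1, h2, hnorm, Pi.one_apply]
  · filter_upwards [hu.sec_eq] with ω h1
    rw [h1]
    by_cases h0 : sec y.1 ω = 0
    · rw [h0, norm_zero, Complex.ofReal_zero, zero_smul]
    · have h0' := norm_ne_zero_iff.2 h0
      rw [if_neg h0', Complex.ofReal_zero, zero_smul, add_zero, smul_smul, ← Complex.ofReal_mul,
        mul_inv_cancel₀ h0', Complex.ofReal_one, one_smul]

theorem numericalRange_nonempty (hS : m ≠ 0) (T : L22 μ m q →ₗ[ℂ] L22 μ m q) :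
    (numericalRange T).Nonempty := by
  obtain ⟨u, hu, -⟩ := exists_norm_eq_one_sec_eq_smul hS (0 : L22 μ m q)
  exact ⟨_, u, hu, rfl⟩

theorem exists_mem_numericalRange_inner_eq (hS : m ≠ 0) (hT : Decomposes T t) (y : L22 μ m q) :
    ∃ z ∈ numericalRange T,
      ∀ᵐ ω ∂μ, ⟪sec y.1 ω, t ω (sec y.1 ω)⟫_ℂ = z ω * ((‖sec y.1 ω‖ ^ 2 : ℝ) : ℂ) := by
  obtain ⟨u, hu, hyu⟩ := exists_norm_eq_one_sec_eq_smul hS y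
  refine ⟨_, ⟨u, hu, rfl⟩, ?_⟩
  filter_upwards [hyu, hT.inner₀_apply_self u] with ω h1 h2
  rw [h2]
  generalize ‖sec y.1 ω‖ = r at h1 ⊢
  rw [h1, map_smul, inner_smul_left, inner_smul_right, Complex.conj_ofReal]
  push_cast
  ring

theorem mul_norm_sq_le_inner_of_mem_lowerBounds (hS : m ≠ 0) (hT : Decomposes T t)
    {lo : Ω →ₘ[μ] ℝ} (hlo : toComplex lo ∈ lowerBounds (numericalRange T)) (y : L22 μ m q) :
    ∀ᵐ ω ∂μ, ((lo ω * ‖sec y.1 ω‖ ^ 2 : ℝ) : ℂ) ≤ ⟪sec y.1 ω, t ω (sec y.1 ω)⟫_ℂ := by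
  obtain ⟨z, hz, hyz⟩ := exists_mem_numericalRange_inner_eq hS hT y
  filter_upwards [hyz, AEEqFun.coeFn_le.2 (hlo hz), coeFn_toComplex lo] with ω h1 h2 h3
  rw [h1, Complex.ofReal_mul, ← h3]
  exact mul_le_mul_of_nonneg_right h2 (Complex.zero_le_real.2 (sq_nonneg _))

theorem inner_le_mul_norm_sq_of_mem_upperBounds (hS : m ≠ 0) (hT : Decomposes T t)
    {hi : Ω →ₘ[μ] ℝ} (hhi : toComplex hi ∈ upperBounds (numericalRange T)) (y : L22 μ m q) :
    ∀ᵐ ω ∂μ, ⟪sec y.1 ω, t ω (sec y.1 ω)⟫_ℂ ≤ ((hi ω * ‖sec y.1 ω‖ ^ 2 : ℝ) : ℂ) := by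
  obtain ⟨z, hz, hyz⟩ := exists_mem_numericalRange_inner_eq hS hT y
  filter_upwards [hyz, AEEqFun.coeFn_le.2 (hhi hz), coeFn_toComplex hi] with ω h1 h2 h3
  rw [h1, Complex.ofReal_mul, ← h3]
  exact mul_le_mul_of_nonneg_right h2 (Complex.zero_le_real.2 (sq_nonneg _))

end NumericalRange

/-! ### Properties of the glued spectral projections -/

section Properties

variable {Ω S : Type*} [MeasurableSpace Ω] [MeasurableSpace S] {μ : Measure Ω} {m : Measure S}
  [IsFiniteMeasure m] {q : ℝ≥0∞} {T E E' : L22 μ m q →ₗ[ℂ] L22 μ m q}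
  {t : Ω → Lp ℂ 2 m →L[ℂ] Lp ℂ 2 m} {l l' : Ω →ₘ[μ] ℝ}

theorem isOrthogonalProjector_of_decomposes
    (hE : Decomposes E fun ω => spectralProjection (t ω) (l ω)) : IsOrthogonalProjector E where
  l0_linear := hE.isL0Linear
  l0_bounded := hE.isL0Bounded (.of_forall fun _ => Submodule.starProjection_norm_le _)
  idempotent x := (hE.apply (hE x)).l22_ext
    ((hE x).congr (.of_forall fun _ => (spectralProjection_spectralProjection _ _ _).symm))
  symmetric x y := by
    refine AEEqFun.ext ?_
    filter_upwards [(hE x).inner₀ (hasSections_sec y), (hasSections_sec x).inner₀ (hE y)]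
      with ω h1 h2
    rw [h1, h2, inner_spectralProjection_left]

theorem isGluedFrom_of_decomposes {k : Ω → S → S → ℂ} {K : ℝ}
    (hk : ∀ᵐ ω ∂μ, IsFiberKernel m K (k ω))
    (hE : Decomposes E fun ω => spectralProjection (fiberCLM m k K ω) (l ω)) :
    IsGluedFrom k l E := by
  intro x
  filter_upwards [hE x, x.2.1, hk] with ω hEx hx hkω
  refine ⟨hx, ?_⟩
  rw [fiberSpectralProjection_eq_spectralProjection hkω, ← sec_eq_toLp hx]
  exact hEx

theorem opLE_comp_scalarMul (ht : ∀ᵐ ω ∂μ, IsCompactSymmetric (t ω)) (hT : Decomposes T t)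
    (hE : Decomposes E fun ω => spectralProjection (t ω) (l ω)) :
    OpLE (fun x => (E (T x)).1) fun x => scalarMul μ m (toComplex l) (E x) := by
  intro x
  rw [← AEEqFun.coeFn_le]
  filter_upwards [ht, (hE.apply (hT x)).inner₀ (hasSections_sec x),
    ((hE x).scalarMul (toComplex l)).inner₀ (hasSections_sec x), coeFn_toComplex l]
    with ω h1 h2 h3 h4
  rw [h2, h3, h4]
  exact h1.inner_spectralProjection_apply_le _ _

theorem opLE_scalarMul_sub (ht : ∀ᵐ ω ∂μ, IsCompactSymmetric (t ω)) (hT : Decomposes T t)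
    (hE : Decomposes E fun ω => spectralProjection (t ω) (l ω)) :
    OpLE (fun x => scalarMul μ m (toComplex l) (x - E x : L22 μ m q))
      fun x => (T (x - E x)).1 := by
  intro x
  have hx := hasSections_sec x
  have hd : HasSections (x - E x : L22 μ m q).1 _ := hx.sub (hE x)
  rw [← AEEqFun.coeFn_le]
  filter_upwards [ht, (hT.apply hd).inner₀ hx, (hd.scalarMul (toComplex l)).inner₀ hx,
    coeFn_toComplex l] with ω h1 h2 h3 h4
  rw [h2, h3, h4]
  exact h1.inner_smul_le_apply_sub_spectralProjection _ _

theorem opLE_of_le (ht : ∀ᵐ ω ∂μ, IsCompactSymmetric (t ω)) (h : l ≤ l')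
    (hE : Decomposes E fun ω => spectralProjection (t ω) (l ω))
    (hE' : Decomposes E' fun ω => spectralProjection (t ω) (l' ω)) :
    OpLE (fun x => (E x).1) fun x => (E' x).1 := by
  intro x
  rw [← AEEqFun.coeFn_le]
  filter_upwards [ht, (hE x).inner₀ (hasSections_sec x), (hE' x).inner₀ (hasSections_sec x),
    AEEqFun.coeFn_le.2 h] with ω h1 h2 h3 h4
  rw [h2, h3]
  exact h1.inner_spectralProjection_mono h4 _

theorem isLUB_strictlyBelow (ht : ∀ᵐ ω ∂μ, IsCompactSymmetric (t ω))
    {E : (Ω →ₘ[μ] ℝ) → (L22 μ m q →ₗ[ℂ] L22 μ m q)}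
    (hE : ∀ l, Decomposes (E l) fun ω => spectralProjection (t ω) (l ω)) (l' : Ω →ₘ[μ] ℝ)
    (x : L22 μ m q) :
    IsLUB {z | ∃ l, StrictlyBelow l l' ∧ z = inner₀ (E l x).1 x.1} (inner₀ (E l' x).1 x.1) := by
  have := Complex.orderClosedTopology
  have hinner (l) := (hE l x).inner₀ (hasSections_sec x)
  refine ⟨?_, fun z hz => ?_⟩
  · rintro _ ⟨l, hl, rfl⟩
    exact opLE_of_le ht (AEEqFun.coeFn_le.1 (hl.mono fun _ => le_of_lt)) (hE l) (hE l') x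
  · obtain ⟨u, hu, hlim⟩ := exists_seq_strictlyBelow_tendsto l'
    have hle (n) : inner₀ (E (u n) x).1 x.1 ≤ z := hz ⟨_, hu n, rfl⟩
    rw [← AEEqFun.coeFn_le]
    filter_upwards [ht, hlim, ae_all_iff.2 hu, hinner l', ae_all_iff.2 fun n => hinner (u n),
      ae_all_iff.2 fun n => AEEqFun.coeFn_le.2 (hle n)] with ω htω hlim hlt h1 h2 hle
    rw [h1]
    simp only [h2] at hle
    exact le_of_tendsto'
      (tendsto_const_nhds.inner (htω.tendsto_spectralProjection_of_lt hlim hlt _)) hle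

variable [IsFiniteMeasure μ]

theorem eq_zero_of_strictlyBelow (ht : ∀ᵐ ω ∂μ, IsCompactSymmetric (t ω)) (hS : m ≠ 0)
    (hT : Decomposes T t) {lo : Ω →ₘ[μ] ℝ}
    (hlo : toComplex lo ∈ lowerBounds (numericalRange T)) (h : StrictlyBelow l lo)
    (hE : Decomposes E fun ω => spectralProjection (t ω) (l ω)) : E = 0 := by
  refine LinearMap.ext fun x => (hE x).l22_ext (HasSections.zero.congr ?_)
  filter_upwards [ht, h, mul_norm_sq_le_inner_of_mem_lowerBounds hS hT hlo (E x), (hE x).sec_eq]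
    with ω h1 h2 h3 h4
  rw [h4] at h3
  exact (h1.spectralProjection_apply_eq_zero h2 _ h3).symm

theorem eq_id_of_strictlyBelow (ht : ∀ᵐ ω ∂μ, IsCompactSymmetric (t ω)) (hS : m ≠ 0)
    (hT : Decomposes T t) {hi : Ω →ₘ[μ] ℝ}
    (hhi : toComplex hi ∈ upperBounds (numericalRange T)) (h : StrictlyBelow hi l)
    (hE : Decomposes E fun ω => spectralProjection (t ω) (l ω)) : E = LinearMap.id := by
  refine LinearMap.ext fun x => (hE x).l22_ext ((hasSections_sec x).congr ?_)
  filter_upwards [ht, h, inner_le_mul_norm_sq_of_mem_upperBounds hS hT hhi (x - E x),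
    sec_sub x (E x), (hE x).sec_eq] with ω h1 h2 h3 h4 h5
  rw [h4, h5] at h3
  exact (h1.spectralProjection_apply_eq_self h2 _ h3).symm

end Properties

end

end PartialIntegral

theorem mainTheorem2_general {Ω S : Type*} [MeasurableSpace Ω] [MeasurableSpace S]
    (μ : Measure Ω) (m : Measure S) [IsFiniteMeasure μ] [IsFiniteMeasure m]
    (hS : m ≠ 0) (q : ℝ≥0∞) (k : Ω → S → S → ℂ)
    (hk : IsBoundedKernel μ m k)
    (hherm : IsHermitianKernel μ m k) :
    ∃ lo hi : Ω →ₘ[μ] ℝ,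
      IsGLB (numericalRange (partialIntegralOperator hk q)) (toComplex lo) ∧
      IsLUB (numericalRange (partialIntegralOperator hk q)) (toComplex hi) ∧
      ∃ E : (Ω →ₘ[μ] ℝ) → (L22 μ m q →ₗ[ℂ] L22 μ m q),
        (∀ l, IsOrthogonalProjector (E l)) ∧
        (∀ l, IsGluedFrom k l (E l)) ∧
        (∀ l, ∀ C : L22 μ m q →ₗ[ℂ] L22 μ m q, IsL0Linear C → IsL0Bounded C →
          C ∘ₗ partialIntegralOperator hk q = partialIntegralOperator hk q ∘ₗ C →
          E l ∘ₗ C = C ∘ₗ E l) ∧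
        (∀ l, OpLE (fun x => (E l (partialIntegralOperator hk q x) : Ω × S →ₘ[μ.prod m] ℂ))
          (fun x => scalarMul μ m (toComplex l) (E l x))) ∧
        (∀ l, OpLE (fun x => scalarMul μ m (toComplex l) ((x - E l x : L22 μ m q)))
          (fun x => (partialIntegralOperator hk q (x - E l x) : Ω × S →ₘ[μ.prod m] ℂ))) ∧
        (∀ l l', l ≤ l' → OpLE (fun x => (E l x : Ω × S →ₘ[μ.prod m] ℂ)) (fun x => E l' x)) ∧
        (∀ l', ∀ x : L22 μ m q,
          IsLUB {z | ∃ l, StrictlyBelow l l' ∧ z = inner₀ (E l x : Ω × S →ₘ[μ.prod m] ℂ) x}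
            (inner₀ (E l' x : Ω × S →ₘ[μ.prod m] ℂ) x)) ∧
        (∀ l, StrictlyBelow l lo → E l = 0) ∧
        (∀ l, StrictlyBelow hi l → E l = LinearMap.id) := by
  obtain ⟨K, hK0, hK⟩ := exists_ae_isFiberKernel hk hherm
  have hT := decomposes_partialIntegralOperator (q := q) hk hK
  have ht : ∀ᵐ ω ∂μ, IsCompactSymmetric (fiberCLM m k K ω) :=
    hK.mono fun _ h => isCompactSymmetric_fiberCLM h
  have hN : ∀ᵐ ω ∂μ, ‖fiberCLM m k K ω‖ ≤ K * m.real Set.univ :=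
    .of_forall fun _ => norm_fiberCLM_le hK0
  obtain ⟨lo, hi, hlo, hhi⟩ := exists_isGLB_isLUB_toComplex (numericalRange_nonempty hS _)
    (numericalRange_subset_range_toComplex hT (ht.mono fun _ h => h.isSymmetric))
    (norm_le_of_mem_numericalRange hT hN)
  choose E hE hcomm using
    exists_glued_spectralProjection hT ht (mul_nonneg hK0 measureReal_nonneg) hN
  exact ⟨lo, hi, hlo, hhi, E,
    fun l => isOrthogonalProjector_of_decomposes (hE l),
    fun l => isGluedFrom_of_decomposes hK (hE l),
    hcomm,
    fun l => opLE_comp_scalarMul ht hT (hE l),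
    fun l => opLE_scalarMul_sub ht hT (hE l),
    fun l l' h => opLE_of_le ht h (hE l) (hE l'),
    isLUB_strictlyBelow ht hE,
    fun l h => eq_zero_of_strictlyBelow ht hS hT hlo.1 h (hE l),
    fun l h => eq_id_of_strictlyBelow ht hS hT hhi.1 h (hE l)⟩

theorem mainTheorem2 {Ω S : Type*} [MeasurableSpace Ω] [MeasurableSpace S]
    (μ : Measure Ω) (m : Measure S) [IsFiniteMeasure μ] [IsFiniteMeasure m]
    (hS : m ≠ 0) (q : ℝ≥0∞) (k : Ω → S → S → ℂ)
    (hk : IsBoundedKernel μ m k)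
    (hherm : IsHermitianKernel μ m k)
    (hpos : IsPosSemidefKernel μ m q k) :
    ∃ lo hi : Ω →ₘ[μ] ℝ,
      IsGLB (numericalRange (partialIntegralOperator hk q)) (toComplex lo) ∧
      IsLUB (numericalRange (partialIntegralOperator hk q)) (toComplex hi) ∧
      ∃ E : (Ω →ₘ[μ] ℝ) → (L22 μ m q →ₗ[ℂ] L22 μ m q),
        (∀ l, IsOrthogonalProjector (E l)) ∧
        (∀ l, IsGluedFrom k l (E l)) ∧
        (∀ l, ∀ C : L22 μ m q →ₗ[ℂ] L22 μ m q, IsL0Linear C → IsL0Bounded C →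
          C ∘ₗ partialIntegralOperator hk q = partialIntegralOperator hk q ∘ₗ C →
          E l ∘ₗ C = C ∘ₗ E l) ∧
        (∀ l, OpLE (fun x => (E l (partialIntegralOperator hk q x) : Ω × S →ₘ[μ.prod m] ℂ))
          (fun x => scalarMul μ m (toComplex l) (E l x))) ∧
        (∀ l, OpLE (fun x => scalarMul μ m (toComplex l) ((x - E l x : L22 μ m q)))
          (fun x => (partialIntegralOperator hk q (x - E l x) : Ω × S →ₘ[μ.prod m] ℂ))) ∧
        (∀ l l', l ≤ l' → OpLE (fun x => (E l x : Ω × S →ₘ[μ.prod m] ℂ)) (fun x => E l' x)) ∧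
        (∀ l', ∀ x : L22 μ m q,
          IsLUB {z | ∃ l, StrictlyBelow l l' ∧ z = inner₀ (E l x : Ω × S →ₘ[μ.prod m] ℂ) x}
            (inner₀ (E l' x : Ω × S →ₘ[μ.prod m] ℂ) x)) ∧
        (∀ l, StrictlyBelow l lo → E l = 0) ∧
        (∀ l, StrictlyBelow hi l → E l = LinearMap.id) :=
  mainTheorem2_general μ m hS q k hk hherm
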